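/- **Conventions.** Let $\mathbb K$ be an algebraically closed field and $m,n\ge 1$. Write $[k]=\{1,\dots,k\}$. Let $\mathbb K[x_{ij}]=\mathbb K[x_{ij}:i\in[m],\,j\in[n]]$ be the coordinate ring of the space $\mathsf{Mat}_{m\times n}$ of $m\times n$ matrices over $\mathbb K$, and let $\mathcal X=[x_{ij}]$. Use the graded reverse lexicographic term order: $\prod x_{ij}^{a_{ij}}<\prod x_{ij}^{b_{ij}}$ if and only if the degree of the first monomial is smaller, or the degrees agree, the monomials are distinct, and $a_{ij}>b_{ij}$ at the lexicographically largest $(i,j)$ with $a_{ij}\ne b_{ij}$. For a polynomial $f\neq 0$ let $\operatorname{init}(f)$ be its largest monomial (without coefficient), let $\operatorname{init}(0)=0$, and for an ideal $I$ let $\operatorname{init}(I)$ be the ideal generated by all $\operatorname{init}(f)$, $f\in I$. Let $(I:\langle f\rangle)=\{g: fg\in I\}$. **Transition systems.** A set $\mathcal T$ of pairs $(I,J)$ of proper ideals is a *transition system* if * (T1) for all $(I,J)\in\mathcal T$, $J$ is a monomial ideal contained in $\operatorname{init}(I)$, with $J=\operatorname{init}(I)$ if $I$ is maximal; * (T2)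 if $(I,J),(I',J')\in\mathcal T$ and $I=I'$ then $J=J'$; * for every $(I,J)\in\mathcal T$ with $I$ not maximal and $I\neq J$ there is a *transition* $(f,\Phi)$ for $(I,J)$ in $\mathcal T$, meaning a non-constant polynomial $f\notin I$ and a nonempty finite subset $\Phi\subseteq\mathcal T$ such that * (T3) $I+\langle f\rangle\subseteq\bigcap_{(P,Q)\in\Phi}P$ and $J+\langle\operatorname{init}(f)\rangle=\bigcap_{(P,Q)\in\Phi}Q$; * (T4) if $(I:\langle f\rangle)\ne I$ then $\big((I:\langle f\rangle),(J:\langle\operatorname{init}(f)\rangle)\big)\in\mathcal T$. **Matrix Schubert varieties.** For a matrix $M$ let $M_{[i][j]}$ be its upper left $i\times j$ submatrix. For $w\in\mathsf{Mat}_{m\times n}$ let $\mathsf{MSV}_w=\{M\in\mathsf{Mat}_{m\times n}:\operatorname{rank}M_{[i][j]}\le\operatorname{rank}w_{[i][j]}\text{ for all }(i,j)\in[m]\times[n]\}$, and let $I(\mathsf{MSV}_w)$ be its vanishing ideal. For a $k\times k$ matrix $M$ let $\operatorname{adiag}(M)=M_{1,k}M_{2,k-1}\cdots M_{k,1}$,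 and let $$J_w=\big\langle\operatorname{adiag}(\mathcal X_{RC}): i\in[m],\ j\in[n],\ R\subseteq[i],\ C\subseteq[j],\ |R|=|C|=1+\operatorname{rank}w_{[i][j]}\big\rangle,$$ where $\mathcal X_{RC}$ is the submatrix of $\mathcal X$ with rows $R$ and columns $C$. **Permutations.** Let $S_\infty$ be the group of permutations of $\{1,2,3,\dots\}$ with finite support. Let $S_\infty^{(m,n)}$ be the set of $w\in S_\infty$ such that $w(i)>w(i+1)$ only if $i\le m$, and $w^{-1}(i)>w^{-1}(i+1)$ only if $i\le n$. Identify $w\in S_\infty$ with the infinite matrix with $1$ in each position $(i,w(i))$ and $0$ elsewhere. For $w\in S^{(m,n)}_\infty$, let $\mathsf{MSV}_w$ and $J_w$ be the objects attached to the upper left $m\times n$ corner of this matrix. Let $\mathsf{dom}(w)=\{(i,j):i,j\geq 1,\ \operatorname{rank}w_{[i][j]}=0\}$; this is a Young diagram. An *outer corner* of it is a position $(p,q)\notin\mathsf{dom}(w)$ such that $\mathsf{dom}(w)\cup\{(p,q)\}$ is a Young diagram. For $p<r$ let $t_{pr}$ be the transposition of $p$ and $r$. The Bruhat order on $S_\infty$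 is the partial order generated by $u<ut_{ij}$ for $i<j$ with $u(i)<u(j)$; write $u\lessdot v$ if $v$ covers $u$ in it. **Theorem.** The set $$\mathcal T=\{(I(\mathsf{MSV}_w),J_w):w\in\mathsf{Mat}_{m\times n}\}$$ is a finite transition system, and $\mathcal T=\{(I(\mathsf{MSV}_w),J_w):w\in S_\infty^{(m,n)}\}$. Moreover, let $w\in S^{(m,n)}_\infty$ be such that $I(\mathsf{MSV}_w)$ is not maximal. Then $\mathsf{dom}(w)$ has an outer corner in $[m]\times[n]$. For every such outer corner $(p,q)$, the set $\mathcal C(w)=\{wt_{pr}:r>p,\ w\lessdot wt_{pr}\}$ is contained in $S^{(m,n)}_\infty$, and $$f=x_{pq},\qquad \Phi=\{(I(\mathsf{MSV}_v),J_v):v\in\mathcal C(w)\}$$ is a transition for $(I(\mathsf{MSV}_w),J_w)$ in $\mathcal T$. That is, $f\notin I(\mathsf{MSV}_w)$ is non-constant, $\Phi\subseteq\mathcal T$ is finite and nonempty, and (T3) and (T4) hold. -/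

import Mathlib

noncomputable section

open MvPolynomial

namespace TransitionSystems

/-! ### The graded reverse lexicographic term order -/

/-- Exponent vectors of monomials in the variables `σ`, to be ordered by the graded reverse
lexicographic order. -/
def GrevLex (σ : Type*) := σ →₀ ℕ

instance (σ : Type*) : AddCommMonoid (GrevLex σ) :=
  inferInstanceAs (AddCommMonoid (σ →₀ ℕ))

/-- The identity map, from exponent vectors to the type that carries the order. -/
def toGrevLex {σ : Type*} : (σ →₀ ℕ) ≃+ GrevLex σ where
  toFun a := a
  invFun a := a
  left_inv _ := rfl
  right_inv _ := rfl
  map_add' _ _ := rfl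

/-- The key by which exponent vectors are compared: first the degree, then the reversed
colexicographic order (the colexicographic order compares at the largest index where two vectors
differ). -/
def grevLexKey {σ : Type*} (a : GrevLex σ) : ℕ ×ₗ (Colex (σ →₀ ℕ))ᵒᵈ :=
  toLex ((toGrevLex.symm a).degree, OrderDual.toDual (toColex (toGrevLex.symm a)))

theorem grevLexKey_injective {σ : Type*} :
    Function.Injective (grevLexKey : GrevLex σ → ℕ ×ₗ (Colex (σ →₀ ℕ))ᵒᵈ) := by
  intro a b h
  exact (Prod.mk.inj h).2

instance (σ : Type*) [LinearOrder σ] : LinearOrder (GrevLex σ) :=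
  LinearOrder.lift' grevLexKey grevLexKey_injective

/-- `x^a < x^b` iff `deg x^a < deg x^b`, or the degrees agree and `a s > b s` at the largest
index `s` where `a` and `b` differ. -/
theorem grevLex_lt_iff {σ : Type*} [LinearOrder σ] (a b : σ →₀ ℕ) :
    toGrevLex a < toGrevLex b ↔
      a.degree < b.degree ∨
        (a.degree = b.degree ∧ ∃ s, (∀ t, s < t → a t = b t) ∧ b s < a s) := by
  change grevLexKey (toGrevLex a) < grevLexKey (toGrevLex b) ↔ _
  have h : toColex b < toColex a ↔ ∃ s, (∀ t, s < t → a t = b t) ∧ b s < a s := by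
    rw [Finsupp.Colex.lt_iff]
    simp only [ofColex_toColex]
    simp only [eq_comm]
  rw [← h]
  simp [grevLexKey, Prod.Lex.toLex_lt_toLex]

theorem degree_le_of_grevLex_le {σ : Type*} [LinearOrder σ] {a b : σ →₀ ℕ}
    (h : toGrevLex a ≤ toGrevLex b) : a.degree ≤ b.degree := by
  rcases h.lt_or_eq with h | h
  · rcases (grevLex_lt_iff a b).1 h with h | h
    · exact h.le
    · exact h.1.le
  · rw [toGrevLex.injective h]

instance (σ : Type*) [LinearOrder σ] : IsOrderedAddMonoid (GrevLex σ) where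
  add_le_add_left a b h c := by
    obtain ⟨a, rfl⟩ := toGrevLex.surjective a
    obtain ⟨b, rfl⟩ := toGrevLex.surjective b
    obtain ⟨c, rfl⟩ := toGrevLex.surjective c
    rcases h.lt_or_eq with h | h
    · rw [← map_add, ← map_add]
      refine le_of_lt ((grevLex_lt_iff _ _).2 ?_)
      simpa [Finsupp.add_apply, map_add] using (grevLex_lt_iff a b).1 h
    · rw [h]

instance (σ : Type*) [LinearOrder σ] [Finite σ] : WellFoundedLT (GrevLex σ) := by
  refine ⟨WellFounded.wellFounded_iff_has_min.2 ?_⟩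
  rintro s ⟨a, ha⟩
  have hfin : (s ∩ Set.Iic a).Finite := by
    refine Set.Finite.subset (Finsupp.finite_of_degree_le (toGrevLex.symm a).degree) ?_
    rintro b ⟨-, hb⟩
    exact degree_le_of_grevLex_le (a := toGrevLex.symm b) (b := toGrevLex.symm a) hb
  obtain ⟨c, hc⟩ := hfin.exists_minimal ⟨a, ha, Set.mem_Iic.2 le_rfl⟩
  refine ⟨c, hc.1.1, fun y hy hyc => ?_⟩
  exact absurd (hc.2 ⟨hy, hyc.le.trans hc.1.2⟩ hyc.le) (not_le.2 hyc)

/-- The (graded) reverse lexicographic term order on monomials in finitely many linearly ordered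
variables. -/
def grevLex (σ : Type*) [LinearOrder σ] [Finite σ] : MonomialOrder σ where
  syn := GrevLex σ
  toSyn := toGrevLex
  toSyn_monotone := by
    intro a b h
    obtain ⟨c, rfl⟩ := le_iff_exists_add.1 h
    have h0 : toGrevLex (0 : σ →₀ ℕ) ≤ toGrevLex c := by
      by_cases hc : c = 0
      · rw [hc]
      · refine le_of_lt ((grevLex_lt_iff _ _).2 (Or.inl ?_))
        rw [map_zero]
        exact Nat.pos_of_ne_zero fun h => hc ((Finsupp.degree_eq_zero_iff c).1 h)
    have h1 := add_le_add_right h0 (toGrevLex a)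
    rwa [← map_add, ← map_add, add_zero] at h1

/-! ### Initial ideals and transition systems -/

section General

variable {σ : Type*} {K : Type*} [Field K]

/-- The initial term of `f`: its largest monomial (with coefficient `1`), or `0` if `f = 0`. -/
def initTerm (ord : MonomialOrder σ) (f : MvPolynomial σ K) : MvPolynomial σ K :=
  open Classical in if f = 0 then 0 else monomial (ord.degree f) 1

/-- The initial ideal of `I`. -/
def initIdeal (ord : MonomialOrder σ) (I : Ideal (MvPolynomial σ K)) :
    Ideal (MvPolynomial σ K) :=
  Ideal.span (initTerm ord '' (I : Set (MvPolynomial σ K)))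

/-- An ideal generated by a set of monomials. -/
def IsMonomialIdeal (J : Ideal (MvPolynomial σ K)) : Prop :=
  ∃ S : Set (σ →₀ ℕ), J = Ideal.span ((fun a => monomial a (1 : K)) '' S)

/-- The polynomial `f` and the set `Φ` are as required, in a transition system `T`, of a pair
`(I, J)`. Here `I.colon {f}` is the ideal quotient `{g | g * f ∈ I}`. -/
structure IsTransition (ord : MonomialOrder σ)
    (T : Set (Ideal (MvPolynomial σ K) × Ideal (MvPolynomial σ K)))
    (I J : Ideal (MvPolynomial σ K)) (f : MvPolynomial σ K)
    (Φ : Set (Ideal (MvPolynomial σ K) × Ideal (MvPolynomial σ K))) : Prop where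
  nonconstant : ∀ c : K, f ≠ C c
  notMem : f ∉ I
  nonempty : Φ.Nonempty
  finite : Φ.Finite
  subset : Φ ⊆ T
  sup_le : I ⊔ Ideal.span {f} ≤ ⨅ P ∈ Φ, P.1
  sup_eq : J ⊔ Ideal.span {initTerm ord f} = ⨅ P ∈ Φ, P.2
  colon_mem : I.colon {f} ≠ I → (I.colon {f}, J.colon {initTerm ord f}) ∈ T

/-- Transition systems of pairs of ideals, with respect to a term order. -/
structure IsTransitionSystem (ord : MonomialOrder σ)
    (T : Set (Ideal (MvPolynomial σ K) × Ideal (MvPolynomial σ K))) : Prop where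
  proper : ∀ P ∈ T, P.1 ≠ ⊤ ∧ P.2 ≠ ⊤
  monomial : ∀ P ∈ T, IsMonomialIdeal P.2
  le_init : ∀ P ∈ T, P.2 ≤ initIdeal ord P.1
  eq_init : ∀ P ∈ T, P.1.IsMaximal → P.2 = initIdeal ord P.1
  unique : ∀ P ∈ T, ∀ Q ∈ T, P.1 = Q.1 → P.2 = Q.2
  transition : ∀ P ∈ T, ¬ P.1.IsMaximal → P.1 ≠ P.2 →
    ∃ f Φ, IsTransition ord T P.1 P.2 f Φ

end General

/-! ### Matrix Schubert varieties -/

section Schubert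

variable {K : Type*} [Field K] {m n : ℕ}

/-- The rank of the northwest submatrix of `M` consisting of the rows up to and including `i` and
the columns up to and including `j`. -/
def nwRank (M : Matrix (Fin m) (Fin n) K) (i : Fin m) (j : Fin n) : ℕ :=
  (M.submatrix (fun r : {r : Fin m // r ≤ i} => r.1) (fun c : {c : Fin n // c ≤ j} => c.1)).rank

/-- The matrix Schubert variety of `w`. -/
def MSV (w : Matrix (Fin m) (Fin n) K) : Set (Matrix (Fin m) (Fin n) K) :=
  {M | ∀ i j, nwRank M i j ≤ nwRank w i j}

/-- The index set of the variables `x_ij` of the coordinate ring of the space of `m × n` matrices,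
with the lexicographic order on pairs. -/
abbrev Pos (m n : ℕ) := Fin m ×ₗ Fin n

/-- The coordinate function `x_ij`. -/
def xVar (K : Type*) [Field K] {m n : ℕ} (i : Fin m) (j : Fin n) : MvPolynomial (Pos m n) K :=
  X (toLex (i, j))

/-- The matrix of variables. -/
def genericMatrix (K : Type*) [Field K] (m n : ℕ) :
    Matrix (Fin m) (Fin n) (MvPolynomial (Pos m n) K) :=
  Matrix.of fun i j => xVar K i j

/-- The vanishing ideal of a set of matrices. -/
def matrixIdeal (V : Set (Matrix (Fin m) (Fin n) K)) : Ideal (MvPolynomial (Pos m n) K) :=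
  vanishingIdeal K ((fun M (p : Pos m n) => M (ofLex p).1 (ofLex p).2) '' V)

/-- The product of the antidiagonal entries of a square matrix. -/
def adiag {k : ℕ} {A : Type*} [CommRing A] (M : Matrix (Fin k) (Fin k) A) : A :=
  ∏ t : Fin k, M t t.rev

/-- The monomial ideal `J_w`, generated by the antidiagonal terms of the minors of size
`1 + rank w_{[i][j]}` in the rows up to `i` and the columns up to `j`. -/
def antidiagIdeal (w : Matrix (Fin m) (Fin n) K) : Ideal (MvPolynomial (Pos m n) K) :=
  Ideal.span {g | ∃ (i : Fin m) (j : Fin n) (R : Finset (Fin m)) (S : Finset (Fin n))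
    (hR : R.card = 1 + nwRank w i j) (hS : S.card = 1 + nwRank w i j),
    (∀ r ∈ R, r ≤ i) ∧ (∀ c ∈ S, c ≤ j) ∧
    g = adiag ((genericMatrix K m n).submatrix (R.orderEmbOfFin hR) (S.orderEmbOfFin hS))}

/-- The pair `(I(MSV_w), J_w)`. -/
def schubertPair (w : Matrix (Fin m) (Fin n) K) :
    Ideal (MvPolynomial (Pos m n) K) × Ideal (MvPolynomial (Pos m n) K) :=
  (matrixIdeal (MSV w), antidiagIdeal w)

/-- The set of all pairs `(I(MSV_w), J_w)`, for `w` an `m × n` matrix. -/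
def schubertSystem (K : Type*) [Field K] (m n : ℕ) :
    Set (Ideal (MvPolynomial (Pos m n) K) × Ideal (MvPolynomial (Pos m n) K)) :=
  Set.range fun w : Matrix (Fin m) (Fin n) K => schubertPair w

end Schubert

/-! ### Permutations

Permutations of the positive integers are encoded as permutations of `ℕ`, so that all positions
and values are shifted down by one. -/

/-- The finitely supported permutations whose right descents are in `{1, …, m}` and whose left
descents are in `{1, …, n}` (these are `{0, …, m - 1}` and `{0, …, n - 1}` after the shift). -/
def SInf (m n : ℕ) : Set (Equiv.Perm ℕ) :=
  {w | {i | w i ≠ i}.Finite ∧ (∀ i, w (i + 1) < w i → i < m) ∧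
    ∀ i, w.symm (i + 1) < w.symm i → i < n}

/-- The upper left `m × n` corner of the permutation matrix with `1` in each position
`(i, w i)`. -/
def permMatrix (K : Type*) [Field K] (m n : ℕ) (w : Equiv.Perm ℕ) : Matrix (Fin m) (Fin n) K :=
  Matrix.of fun i j => if w i = j then 1 else 0

/-- The dominant component of `w`: the positions `(i, j)` such that the northwest submatrix with
last row `i` and last column `j` of the permutation matrix has rank `0`. -/
def dom (K : Type*) [Field K] (w : Equiv.Perm ℕ) : Set (ℕ × ℕ) :=
  {p | (permMatrix K (p.1 + 1) (p.2 + 1) w).rank = 0}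

/-- The outer corners of a Young diagram `D`: the positions that can be added to it. -/
def IsOuterCorner (D : Set (ℕ × ℕ)) (p : ℕ × ℕ) : Prop :=
  p ∉ D ∧ ∃ μ : YoungDiagram, (μ : Set (ℕ × ℕ)) = insert p D

/-- The (strict) Bruhat order: the transitive closure of the relations `u < u t_ij` for `i < j`
with `u(i) < u(j)`. -/
def BruhatLT : Equiv.Perm ℕ → Equiv.Perm ℕ → Prop :=
  Relation.TransGen fun u v => ∃ i j : ℕ, i < j ∧ u i < u j ∧ v = u * Equiv.swap i j

/-- `v` covers `u` in the Bruhat order. -/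
def BruhatCovers (u v : Equiv.Perm ℕ) : Prop :=
  BruhatLT u v ∧ ∀ z, ¬ (BruhatLT u z ∧ BruhatLT z v)

/-- The covers of `w` in the Bruhat order that are of the form `w t_pr` with `p < r`. -/
def transitionCovers (w : Equiv.Perm ℕ) (p : ℕ) : Set (Equiv.Perm ℕ) :=
  {v | ∃ r, p < r ∧ v = w * Equiv.swap p r ∧ BruhatCovers w v}

end TransitionSystems

end

open TransitionSystems

/-!
The theorem rests on one combinatorial statement, `exists_coverPair_le`. Call a function `ρ` of the
pairs `(a, b)` a rank function (`IsRankFn`) if it behaves like the rank of the northwest part of a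
matrix with `a` rows and `b` columns: it vanishes for `a = 0` and for `b = 0`, it grows by `0` or `1`
in each step, and it is supermodular. If `ρ` does not exceed the rank function of a permutation `w`,
and is strictly smaller at a one of `w`, in row `p` say, then `ρ` does not exceed the rank function
of some `w t_pr` that covers `w` in Bruhat order. This is applied to three kinds of rank functions.

* Let `D` be a set of positions, and let `ρ` be the size of a longest antidiagonal in the northwest
  parts of `D`. That `ρ` is supermodular (`chainRank_isRankFn`) follows by exchanging the tails of
  two antidiagonals. A monomial is outside `J_w` if and only if the function `ρ` of its set of
  positions does not exceed the rank function of `w`. So the combinatorial statement says that a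
  monomial outside `J_w + ⟨x_pq⟩` is outside `J_v` for some `v` in `transitionCovers w p`; this is
  the equality of monomial ideals required of a transition (`antidiagIdeal_sup_eq`).

* Let `ρ` be the rank function of a matrix in `MSV_w`. The statement shows that, unless `ρ` is the
  rank function of `w`, the matrix lies in a smaller variety `MSV_v` with `v = w t_pr`. By
  induction it is in the closure of the matrices with the rank function of `v`, and each of these
  can be moved along a line into the matrices with the rank function of `w` (`exists_line`). So
  the matrices with the rank function of `w` are dense in `MSV_w` (`evalAt_eq_zero_of_rank_eq`).
  As `x_pq` does not vanish at any of them, `(I : ⟨x_pq⟩) = I`, and the condition on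
  ideal quotients is vacuous.

* For `ρ = 0`, the statement shows that `transitionCovers w p` is nonempty.

The remaining properties are direct. The antidiagonal term of a minor is its initial term
(`initTerm_det`), matrix Schubert varieties are cut out by minors (`mem_MSV_iff_evalAt`) and
therefore determine the rank conditions, and every rank function is that of a permutation in
`SInf m n` on the `m × n` window (`exists_mem_SInf_of_isRankFn`).
-/

namespace TransitionSystems

open Finset

/-! ### Rank functions -/

/-- The combinatorial properties shared by the rank functions of matrices, of permutations, and of
sets of positions (where the rank is the length of a longest antidiagonal chain). The value
`ρ a b` refers to the rows `< a` and the columns `< b`. -/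
structure IsRankFn (ρ : ℕ → ℕ → ℕ) : Prop where
  zero_left : ∀ b, ρ 0 b = 0
  zero_right : ∀ a, ρ a 0 = 0
  mono_left : ∀ a b, ρ a b ≤ ρ (a + 1) b
  mono_right : ∀ a b, ρ a b ≤ ρ a (b + 1)
  step_left : ∀ a b, ρ (a + 1) b ≤ ρ a b + 1
  step_right : ∀ a b, ρ a (b + 1) ≤ ρ a b + 1
  supermodular : ∀ a b, ρ (a + 1) b + ρ a (b + 1) ≤ ρ (a + 1) (b + 1) + ρ a b

namespace IsRankFn

variable {ρ : ℕ → ℕ → ℕ}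

theorem le_left (h : IsRankFn ρ) {a a' : ℕ} (ha : a ≤ a') (b : ℕ) : ρ a b ≤ ρ a' b :=
  monotone_nat_of_le_succ (f := fun a => ρ a b) (fun a => h.mono_left a b) ha

theorem le_right (h : IsRankFn ρ) (a : ℕ) {b b' : ℕ} (hb : b ≤ b') : ρ a b ≤ ρ a b' :=
  monotone_nat_of_le_succ (h.mono_right a) hb

theorem le_add_left (h : IsRankFn ρ) (a k b : ℕ) : ρ (a + k) b ≤ ρ a b + k := by
  induction k with
  | zero => simp
  | succ k ih => have := h.step_left (a + k) b; rw [← add_assoc]; omega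

theorem le_add_right (h : IsRankFn ρ) (a b k : ℕ) : ρ a (b + k) ≤ ρ a b + k := by
  induction k with
  | zero => simp
  | succ k ih => have := h.step_right a (b + k); rw [← add_assoc]; omega

theorem supermodular' (h : IsRankFn ρ) {a a' b b' : ℕ} (ha : a ≤ a') (hb : b ≤ b') :
    ρ a' b + ρ a b' ≤ ρ a' b' + ρ a b := by
  have key : ∀ a, ρ (a + 1) b + ρ a b' ≤ ρ (a + 1) b' + ρ a b := by
    intro a
    induction b', hb using Nat.le_induction with
    | base => omega
    | succ b' _ ih => have := h.supermodular a b'; omega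
  induction a', ha using Nat.le_induction with
  | base => omega
  | succ a' _ ih => have := key a'; omega

theorem le_of_window (h : IsRankFn ρ) {ρ' : ℕ → ℕ → ℕ} {m n : ℕ}
    (hle : ∀ (i : Fin m) (j : Fin n), ρ (i + 1) (j + 1) ≤ ρ' (i + 1) (j + 1)) {a b : ℕ}
    (ha : a ≤ m) (hb : b ≤ n) : ρ a b ≤ ρ' a b := by
  rcases Nat.eq_zero_or_pos a with rfl | ha0
  · simp [h.zero_left]
  rcases Nat.eq_zero_or_pos b with rfl | hb0
  · simp [h.zero_right]
  have := hle ⟨a - 1, by omega⟩ ⟨b - 1, by omega⟩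
  simpa only [Nat.sub_add_cancel ha0, Nat.sub_add_cancel hb0] using this

/-- Cutting a rank function off outside a window leaves a rank function. -/
theorem window (h : IsRankFn ρ) (m n : ℕ) : IsRankFn fun a b => ρ (min a m) (min b n) := by
  have hmin : ∀ a m, min (a + 1) m = min a m ∨ min (a + 1) m = min a m + 1 := by omega
  refine ⟨?_, ?_, ?_, ?_, ?_, ?_, ?_⟩
  · intro b; simp [h.zero_left]
  · intro a; simp [h.zero_right]
  · intro a b; exact h.le_left (by omega) _
  · intro a b; exact h.le_right _ (by omega)
  · intro a b
    rcases hmin a m with e | e <;> simp only [e]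
    · omega
    · exact h.step_left _ _
  · intro a b
    rcases hmin b n with e | e <;> simp only [e]
    · omega
    · exact h.step_right _ _
  · intro a b; exact h.supermodular' (by omega) (by omega)

end IsRankFn

/-! ### Rank functions of permutations -/

/-- The number of ones in the rows `< a` and the columns `< b` of the permutation matrix of `w`. -/
def permRank (w : Equiv.Perm ℕ) (a b : ℕ) : ℕ := #{k ∈ range a | w k < b}

theorem permRank_succ_left (w : Equiv.Perm ℕ) (a b : ℕ) :
    permRank w (a + 1) b = permRank w a b + if w a < b then 1 else 0 := by
  unfold permRank
  rw [range_add_one, filter_insert]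
  split_ifs with h <;> simp

theorem permRank_zero_left (w : Equiv.Perm ℕ) (b : ℕ) : permRank w 0 b = 0 := by
  simp [permRank]

theorem permRank_symm (w : Equiv.Perm ℕ) (a b : ℕ) : permRank w.symm b a = permRank w a b := by
  unfold permRank
  refine card_bij (fun k _ => w.symm k) ?_ ?_ ?_
  · intro k; simp only [mem_filter, mem_range, Equiv.apply_symm_apply]; tauto
  · intro k _ l _ h; exact w.symm.injective h
  · intro k hk
    simp only [mem_filter, mem_range] at hk ⊢
    exact ⟨w k, by simpa using hk.symm, by simp⟩

theorem permRank_succ_right (w : Equiv.Perm ℕ) (a b : ℕ) :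
    permRank w a (b + 1) = permRank w a b + if w.symm b < a then 1 else 0 := by
  rw [← permRank_symm, permRank_succ_left, permRank_symm]

theorem permRank_isRankFn (w : Equiv.Perm ℕ) : IsRankFn (permRank w) where
  zero_left := permRank_zero_left w
  zero_right a := by simp [permRank]
  mono_left a b := by rw [permRank_succ_left]; omega
  mono_right a b := by rw [permRank_succ_right]; omega
  step_left a b := by rw [permRank_succ_left]; split_ifs <;> omega
  step_right a b := by rw [permRank_succ_right]; split_ifs <;> omega
  supermodular a b := by
    rw [permRank_succ_left, permRank_succ_left]
    split_ifs <;> omega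

theorem permRank_rectangle {w : Equiv.Perm ℕ} {a a' b b' : ℕ} (ha : a ≤ a') (hb : b ≤ b')
    (h : ∀ k, a ≤ k → k < a' → b ≤ w k → w k < b' → False) :
    permRank w a' b' + permRank w a b = permRank w a' b + permRank w a b' := by
  induction a', ha using Nat.le_induction with
  | base => omega
  | succ c hc ih =>
    have ih := ih fun k h1 h2 => h k h1 (by omega)
    have : ¬ (b ≤ w c ∧ w c < b') := fun h' => h c hc (by omega) h'.1 h'.2
    rw [permRank_succ_left, permRank_succ_left]
    split_ifs <;> omega

theorem permRank_add_left {w : Equiv.Perm ℕ} {a b : ℕ} (k : ℕ)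
    (h : ∀ i, a ≤ i → i < a + k → w i < b) : permRank w (a + k) b = permRank w a b + k := by
  induction k with
  | zero => simp
  | succ k ih =>
    rw [← add_assoc, permRank_succ_left, ih fun i h1 h2 => h i h1 (by omega),
      if_pos (h (a + k) (by omega) (by omega)), add_assoc]

theorem permRank_add_right {w : Equiv.Perm ℕ} {a b : ℕ} (k : ℕ)
    (h : ∀ j, b ≤ j → j < b + k → w.symm j < a) : permRank w a (b + k) = permRank w a b + k := by
  rw [← permRank_symm, permRank_add_left k h, permRank_symm]

theorem eq_of_permRank_row {w z : Equiv.Perm ℕ} {a : ℕ} (h : ∀ b, permRank w a b = permRank z a b)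
    (h' : ∀ b, permRank w (a + 1) b = permRank z (a + 1) b) : w a = z a := by
  have key : ∀ b, w a < b ↔ z a < b := by
    intro b
    have h1 := h b
    have h2 := h' b
    rw [permRank_succ_left, permRank_succ_left] at h2
    split_ifs at h2 <;> omega
  have h1 := (key (w a + 1)).1 (by omega)
  have h2 := (key (z a + 1)).2 (by omega)
  omega

theorem permRank_mul_swap {w : Equiv.Perm ℕ} {p r : ℕ} (hpr : p < r) (hw : w p < w r) (a b : ℕ) :
    permRank (w * Equiv.swap p r) a b + (if p < a ∧ a ≤ r ∧ w p < b ∧ b ≤ w r then 1 else 0) =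
      permRank w a b := by
  induction a with
  | zero => simp [permRank_zero_left]
  | succ a ih =>
    rw [permRank_succ_left, permRank_succ_left, ← ih, Equiv.Perm.mul_apply]
    rcases eq_or_ne a p with rfl | hp
    · rw [Equiv.swap_apply_left]
      split_ifs <;> omega
    rcases eq_or_ne a r with rfl | hr
    · rw [Equiv.swap_apply_right]
      split_ifs <;> omega
    · rw [Equiv.swap_apply_of_ne_of_ne hp hr]
      split_ifs <;> omega

theorem le_permRank_mul_swap {ρ : ℕ → ℕ → ℕ} {w : Equiv.Perm ℕ} {p r : ℕ} (hpr : p < r)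
    (hw : w p < w r) (hle : ∀ a b, ρ a b ≤ permRank w a b)
    (hlt : ∀ a b, p < a → a ≤ r → w p < b → b ≤ w r → ρ a b < permRank w a b) (a b : ℕ) :
    ρ a b ≤ permRank (w * Equiv.swap p r) a b := by
  have h1 := permRank_mul_swap hpr hw a b
  have h2 := hle a b
  have h3 := hlt a b
  split_ifs at h1 with h
  · have := h3 h.1 h.2.1 h.2.2.1 h.2.2.2; omega
  · omega

/-- Permutations fixing all large numbers, in a form that provides a bound. -/
theorem exists_bound {w : Equiv.Perm ℕ} (hw : {i | w i ≠ i}.Finite) (c : ℕ) :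
    ∃ N, c < N ∧ ∀ k, N ≤ k → w k = k := by
  obtain ⟨B, hB⟩ := hw.bddAbove
  refine ⟨max B c + 1, by omega, fun k hk => ?_⟩
  by_contra h
  have := hB h
  omega

theorem exists_maximal_run {P : ℕ → Prop} {s N : ℕ} (hs : P s) (hN : s ≤ N) :
    ∃ t, s ≤ t ∧ t ≤ N ∧ (∀ x, s ≤ x → x ≤ t → P x) ∧ (t = N ∨ ¬ P (t + 1)) := by
  induction N, hN using Nat.le_induction with
  | base => exact ⟨s, le_rfl, le_rfl, fun x h1 h2 => by rwa [le_antisymm h2 h1], Or.inl rfl⟩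
  | succ N hN ih =>
    obtain ⟨t, h1, h2, h3, h4⟩ := ih
    rcases h4 with rfl | h4
    · by_cases h : P (t + 1)
      · refine ⟨t + 1, by omega, le_rfl, fun x hx hx' => ?_, Or.inl rfl⟩
        rcases Nat.le_succ_iff.1 hx' with h' | rfl
        · exact h3 x hx h'
        · exact h
      · exact ⟨t, h1, by omega, h3, Or.inr h⟩
    · exact ⟨t, h1, by omega, h3, Or.inr h4⟩

/-- The key combinatorial step. If a rank function lies below that of `w`, and strictly below it at
a one of the matrix of `w`, then that one is the corner of a rectangle, spanned with another one of
`w`, on which the inequality is strict. The rectangle is found as one that is maximal among those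
with the given corner on which the inequality is strict: if it contained no further one of `w`,
then supermodularity would fail. -/
theorem exists_strict_rectangle {ρ : ℕ → ℕ → ℕ} (hρ : IsRankFn ρ) {w : Equiv.Perm ℕ}
    (hw : {i | w i ≠ i}.Finite) (hle : ∀ a b, ρ a b ≤ permRank w a b) {p : ℕ}
    (hp : ρ (p + 1) (w p + 1) < permRank w (p + 1) (w p + 1)) :
    ∃ r, p < r ∧ w p < w r ∧
      ∀ a b, p < a → a ≤ r → w p < b → b ≤ w r → ρ a b < permRank w a b := by
  obtain ⟨N, hN, hfix⟩ := exists_bound hw (p + w p)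
  generalize hq : w p = q at *
  obtain ⟨a1, ha, haN, hA, hA'⟩ := exists_maximal_run (N := N)
    (P := fun a => ρ a (q + 1) < permRank w a (q + 1)) hp (by omega)
  obtain ⟨b1, hb, hbN, hB, hB'⟩ := exists_maximal_run (N := N)
    (P := fun b => ∀ a, p < a → a ≤ a1 → ρ a b < permRank w a b) (s := q + 1)
    (fun a h1 h2 => hA a h1 h2) (by omega)
  have hlt : ∀ k, k < N → w k < N := by
    intro k hk
    by_contra h
    have := w.injective (hfix (w k) (by omega))
    omega
  suffices h : ∃ r, p < r ∧ r ≤ a1 ∧ q < w r ∧ w r ≤ b1 by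
    obtain ⟨r, h1, h2, h3, h4⟩ := h
    exact ⟨r, h1, h3, fun a b h5 h6 h7 h8 => hB b h7 (by omega) a h5 (by omega)⟩
  by_contra! hnot
  have hB'' : b1 = N ∨ ∃ a0, p < a0 ∧ a0 ≤ a1 ∧
      permRank w a0 (b1 + 1) ≤ ρ a0 (b1 + 1) := by
    refine hB'.imp_right fun h => ?_
    push Not at h
    exact h
  rcases hB'' with rfl | ⟨a0, h0, h0', h0''⟩
  · rcases hA' with rfl | hA'
    · have := hnot a1 (by omega) le_rfl (by rw [hfix a1 le_rfl]; omega)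
      rw [hfix a1 le_rfl] at this
      omega
    · have ha1 : a1 ≠ b1 := by
        rintro rfl
        have := hnot a1 (by omega) le_rfl (by rw [hfix a1 le_rfl]; omega)
        rw [hfix a1 le_rfl] at this
        omega
      -- all ones of `w` in the rows of the rectangle lie to the left of it
      have h1 : permRank w (p + 1 + (a1 - p)) (q + 1) = permRank w (p + 1) (q + 1) + (a1 - p) := by
        apply permRank_add_left
        intro i hi hi'
        by_contra h
        have := hnot i (by omega) (by omega) (by omega)
        have := hlt i (by omega)
        omega
      have h2 := hρ.le_add_left (p + 1) (a1 - p) (q + 1)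
      rw [show p + 1 + (a1 - p) = a1 + 1 by omega] at h1 h2
      omega
  · have hA0 := hA a0 h0 h0'
    by_cases haN' : a1 = N
    · subst haN'
      have hb1 : b1 ≠ a1 := by
        rintro rfl
        have := hnot b1 (by omega) le_rfl (by rw [hfix b1 le_rfl]; omega)
        rw [hfix b1 le_rfl] at this
        omega
      -- all ones of `w` in the columns of the rectangle lie above it
      have h1 : permRank w a0 (q + 1 + (b1 - q)) = permRank w a0 (q + 1) + (b1 - q) := by
        apply permRank_add_right
        intro j hj hj'
        by_contra h
        have hj2 : w (w.symm j) = j := by simp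
        by_cases hk : w.symm j ≤ a1
        · have := hnot (w.symm j) (by omega) hk (by omega)
          omega
        · have := hfix (w.symm j) (by omega)
          omega
      have h2 := hρ.le_add_right a0 (q + 1) (b1 - q)
      rw [show q + 1 + (b1 - q) = b1 + 1 by omega] at h1 h2
      omega
    · have hA' := hA'.resolve_left haN'
      have h1 := permRank_rectangle (w := w) (a := a0) (a' := a1 + 1) (b := q + 1) (b' := b1 + 1)
        (by omega) (by omega)
        (fun k h1 h2 h3 h4 => by have := hnot k (by omega) (by omega) (by omega); omega)
      have h2 := hρ.supermodular' (a := a0) (a' := a1 + 1) (b := q + 1) (b' := b1 + 1)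
        (by omega) (by omega)
      have h3 := hle (a1 + 1) (b1 + 1)
      omega

/-- There is a one of `w` properly southeast of the one in row `p`, the one in row `r`, such that
the rectangle between them contains no further ones of `w`. -/
def IsCoverPair (w : Equiv.Perm ℕ) (p r : ℕ) : Prop :=
  p < r ∧ w p < w r ∧ ∀ k, p < k → k < r → w p < w k → w k < w r → False

theorem exists_coverPair_le {ρ : ℕ → ℕ → ℕ} (hρ : IsRankFn ρ) {w : Equiv.Perm ℕ}
    (hw : {i | w i ≠ i}.Finite) (hle : ∀ a b, ρ a b ≤ permRank w a b) {p : ℕ}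
    (hp : ρ (p + 1) (w p + 1) < permRank w (p + 1) (w p + 1)) :
    ∃ r, IsCoverPair w p r ∧ ∀ a b, ρ a b ≤ permRank (w * Equiv.swap p r) a b := by
  classical
  obtain ⟨k, h1, h2, h3⟩ := exists_strict_rectangle hρ hw hle hp
  have hex : ∃ r, p < r ∧ w p < w r ∧ w r ≤ w k := ⟨k, h1, h2, le_rfl⟩
  obtain ⟨h4, h5, h6⟩ := Nat.find_spec hex
  have hmin : ∀ r, r < Nat.find hex → ¬ (p < r ∧ w p < w r ∧ w r ≤ w k) :=
    fun r hr => Nat.find_min hex hr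
  have hfk : Nat.find hex ≤ k := Nat.find_min' hex ⟨h1, h2, le_rfl⟩
  refine ⟨Nat.find hex, ⟨h4, h5, fun l l1 l2 l3 l4 => hmin l l2 ⟨l1, l3, by omega⟩⟩,
    le_permRank_mul_swap h4 h5 hle fun a b a1 a2 b1 b2 => h3 a b a1 (by omega) b1 (by omega)⟩

/-! ### Bruhat order -/

theorem permRank_of_bruhatLT {u v : Equiv.Perm ℕ} (h : BruhatLT u v) :
    (∀ a b, permRank v a b ≤ permRank u a b) ∧ ∃ a b, permRank v a b < permRank u a b := by
  have step : ∀ u v : Equiv.Perm ℕ, (∃ i j : ℕ, i < j ∧ u i < u j ∧ v = u * Equiv.swap i j) →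
      (∀ a b, permRank v a b ≤ permRank u a b) ∧ ∃ a b, permRank v a b < permRank u a b := by
    rintro u _ ⟨i, j, hij, hu, rfl⟩
    refine ⟨fun a b => by have := permRank_mul_swap hij hu a b; omega, i + 1, u i + 1, ?_⟩
    have := permRank_mul_swap hij hu (i + 1) (u i + 1)
    rw [if_pos (by omega)] at this
    omega
  induction h with
  | single h => exact step _ _ h
  | tail _ h ih =>
    refine ⟨fun a b => ((step _ _ h).1 a b).trans (ih.1 a b), ?_⟩
    obtain ⟨a, b, hab⟩ := ih.2
    exact ⟨a, b, ((step _ _ h).1 a b).trans_lt hab⟩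

theorem not_bruhatLT_self (u : Equiv.Perm ℕ) : ¬ BruhatLT u u := fun h => by
  obtain ⟨a, b, h⟩ := (permRank_of_bruhatLT h).2
  omega

theorem bruhatLT_mul_swap {w : Equiv.Perm ℕ} {p r : ℕ} (hpr : p < r) (hw : w p < w r) :
    BruhatLT w (w * Equiv.swap p r) :=
  Relation.TransGen.single ⟨p, r, hpr, hw, rfl⟩

theorem isCoverPair_of_bruhatCovers {w : Equiv.Perm ℕ} {p r : ℕ} (hpr : p < r)
    (h : BruhatCovers w (w * Equiv.swap p r)) : IsCoverPair w p r := by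
  have hw : w p < w r := by
    by_contra hw
    have hne : w p ≠ w r := fun e => hpr.ne (w.injective e)
    have h1 : BruhatLT (w * Equiv.swap p r) w := by
      have := bruhatLT_mul_swap (w := w * Equiv.swap p r) hpr (by simp; omega)
      rwa [mul_assoc, Equiv.swap_mul_self, mul_one] at this
    exact not_bruhatLT_self _ (h.1.trans h1)
  refine ⟨hpr, hw, fun k h1 h2 h3 h4 => h.2 (w * Equiv.swap p k) ⟨bruhatLT_mul_swap h1 h3, ?_⟩⟩
  -- exchange the values `b a c` in the positions `p < k < r` to `b c a` and then to `c b a`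
  have e1 : (w * Equiv.swap p k) k = w p := by simp
  have e2 : (w * Equiv.swap p k) r = w r := by
    rw [Equiv.Perm.mul_apply, Equiv.swap_apply_of_ne_of_ne (by omega) (by omega)]
  have s1 := bruhatLT_mul_swap (w := w * Equiv.swap p k) h2 (by rw [e1, e2]; exact hw)
  have s2 := bruhatLT_mul_swap (w := w * Equiv.swap p k * Equiv.swap k r) h1 (by
    rw [Equiv.Perm.mul_apply, Equiv.Perm.mul_apply _ _ k, Equiv.swap_apply_left, e2,
      Equiv.swap_apply_of_ne_of_ne (by omega) (by omega)]
    simpa using h4)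
  have e : w * Equiv.swap p k * Equiv.swap k r * Equiv.swap p k = w * Equiv.swap p r := by
    rw [mul_assoc, mul_assoc, ← mul_assoc (Equiv.swap p k), Equiv.swap_comm p k,
      Equiv.swap_comm k r, Equiv.swap_mul_swap_mul_swap (by omega) (by omega), Equiv.swap_comm]
  rw [e] at s2
  exact s1.trans s2

/-- A permutation between `w` and `w t_pr` in Bruhat order agrees with `w` in the rows other than
`p` and `r`, as the rank functions of `w` and `w t_pr` differ by at most `1` and agree outside a
rectangle. -/
theorem bruhatCovers_of_isCoverPair {w : Equiv.Perm ℕ} {p r : ℕ} (h : IsCoverPair w p r) :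
    BruhatCovers w (w * Equiv.swap p r) := by
  obtain ⟨hpr, hw, hno⟩ := h
  refine ⟨bruhatLT_mul_swap hpr hw, ?_⟩
  rintro z ⟨hz1, hz2⟩
  have hz1' := (permRank_of_bruhatLT hz1).1
  have hz2' := (permRank_of_bruhatLT hz2).1
  have hout : ∀ a b, ¬ (p < a ∧ a ≤ r ∧ w p < b ∧ b ≤ w r) → permRank z a b = permRank w a b := by
    intro a b hab
    have := permRank_mul_swap hpr hw a b
    rw [if_neg hab] at this
    have := hz1' a b
    have := hz2' a b
    omega
  have hagree : ∀ a, a ≠ p → a ≠ r → z a = w a := by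
    intro a hap har
    by_cases hin : p < a ∧ a < r
    · have key : ∀ b, (b ≤ w p ∨ w r < b) → (w a < b ↔ z a < b) := by
        intro b hb
        have h1 := hout a b (by omega)
        have h2 := hout (a + 1) b (by omega)
        rw [permRank_succ_left, permRank_succ_left] at h2
        split_ifs at h2 <;> omega
      have n1 : w a ≠ w p := fun e => hap (w.injective e)
      have n2 : w a ≠ w r := fun e => har (w.injective e)
      have n3 : ¬ (w p < w a ∧ w a < w r) := fun h => hno a hin.1 hin.2 h.1 h.2
      have k1 := key (w a) (by omega)
      have k2 := key (w a + 1) (by omega)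
      omega
    · exact (eq_of_permRank_row (fun b => (hout a b (by omega)).symm)
        (fun b => (hout (a + 1) b (by omega)).symm)).symm
  have hzp : z p = w p ∨ z p = w r := by
    by_contra! hcon
    obtain ⟨x, hx⟩ : ∃ x, w x = z p := ⟨w.symm (z p), by simp⟩
    have hxp : x ≠ p := fun e => hcon.1 (by rw [← hx, e])
    have hxr : x ≠ r := fun e => hcon.2 (by rw [← hx, e])
    exact hxp (z.injective ((hagree x hxp hxr).trans hx))
  have hzr : z r = w p ∨ z r = w r := by
    by_contra! hcon
    obtain ⟨x, hx⟩ : ∃ x, w x = z r := ⟨w.symm (z r), by simp⟩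
    have hxp : x ≠ p := fun e => hcon.1 (by rw [← hx, e])
    have hxr : x ≠ r := fun e => hcon.2 (by rw [← hx, e])
    exact hxr (z.injective ((hagree x hxp hxr).trans hx))
  have hne : z p ≠ z r := fun e => hpr.ne (z.injective e)
  rcases hzp with hzp | hzp
  · have : z = w := by
      ext a
      by_cases ha : a = p
      · rw [ha, hzp]
      by_cases ha' : a = r
      · rw [ha']; omega
      · exact hagree a ha ha'
    rw [this] at hz1
    exact not_bruhatLT_self _ hz1
  · have : z = w * Equiv.swap p r := by
      ext a
      rw [Equiv.Perm.mul_apply]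
      by_cases ha : a = p
      · rw [ha, hzp, Equiv.swap_apply_left]
      by_cases ha' : a = r
      · rw [ha', Equiv.swap_apply_right]; omega
      · rw [hagree a ha ha', Equiv.swap_apply_of_ne_of_ne ha ha']
    rw [this] at hz2
    exact not_bruhatLT_self _ hz2

theorem mem_transitionCovers {w v : Equiv.Perm ℕ} {p : ℕ} :
    v ∈ transitionCovers w p ↔ ∃ r, IsCoverPair w p r ∧ v = w * Equiv.swap p r := by
  constructor
  · rintro ⟨r, hpr, rfl, h⟩
    exact ⟨r, isCoverPair_of_bruhatCovers hpr h, rfl⟩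
  · rintro ⟨r, h, rfl⟩
    exact ⟨r, h.1, rfl, bruhatCovers_of_isCoverPair h⟩

theorem finite_support_mul_swap {w : Equiv.Perm ℕ} (hw : {i | w i ≠ i}.Finite) (p r : ℕ) :
    {i | (w * Equiv.swap p r) i ≠ i}.Finite := by
  refine (hw.union ((Set.finite_singleton p).union (Set.finite_singleton r))).subset ?_
  intro i hi
  by_contra h
  simp only [Set.mem_union, Set.mem_ofPred_eq, Set.mem_singleton_iff, not_or, not_not] at h
  apply hi
  rw [Equiv.Perm.mul_apply, Equiv.swap_apply_of_ne_of_ne h.2.1 h.2.2, h.1]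

theorem mul_swap_mem_SInf {m n : ℕ} {w : Equiv.Perm ℕ} (hw : w ∈ SInf m n) {p r : ℕ}
    (hp : p < m) (hq : w p < n) (h : IsCoverPair w p r) : w * Equiv.swap p r ∈ SInf m n := by
  obtain ⟨hpr, hlt, hno⟩ := h
  obtain ⟨hfin, hrow, hcol⟩ := hw
  have hne : ∀ {i j}, i ≠ j → w i ≠ w j := fun h e => h (w.injective e)
  have hne' : ∀ {i j}, i ≠ j → w.symm i ≠ w.symm j := fun h e => h (w.symm.injective e)
  refine ⟨finite_support_mul_swap hfin p r, fun i hi => ?_, fun j hj => ?_⟩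
  · by_contra him
    have h1 := hrow i
    have h2 := @hne i (i + 1) (by omega)
    rw [Equiv.Perm.mul_apply, Equiv.Perm.mul_apply] at hi
    by_cases hir : i = r
    · subst hir
      rw [Equiv.swap_apply_right, Equiv.swap_apply_of_ne_of_ne (by omega) (by omega)] at hi
      omega
    rw [Equiv.swap_apply_of_ne_of_ne (by omega) hir] at hi
    by_cases hir' : i + 1 = r
    · rw [hir', Equiv.swap_apply_right] at hi
      rw [hir'] at h1 h2
      exact hno i (by omega) (by omega) hi (by omega)
    · rw [Equiv.swap_apply_of_ne_of_ne (by omega) hir'] at hi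
      omega
  · by_contra hjn
    have h1 := hcol j
    have h2 := @hne' j (j + 1) (by omega)
    have e : ∀ j, (w * Equiv.swap p r).symm j = Equiv.swap p r (w.symm j) := by
      intro j
      rw [Equiv.symm_apply_eq, Equiv.Perm.mul_apply, Equiv.swap_apply_self,
        Equiv.apply_symm_apply]
    have hsp : ∀ {j}, j ≠ w p → w.symm j ≠ p := by
      rintro j hj rfl; exact hj (by simp)
    have hsr : ∀ {j}, j ≠ w r → w.symm j ≠ r := by
      rintro j hj rfl; exact hj (by simp)
    rw [e, e] at hj
    by_cases hjr : j = w r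
    · rw [hjr, Equiv.symm_apply_apply, Equiv.swap_apply_right,
        Equiv.swap_apply_of_ne_of_ne (hsp (by omega)) (hsr (by omega))] at hj
      rw [hjr, Equiv.symm_apply_apply] at h1 h2
      omega
    rw [Equiv.swap_apply_of_ne_of_ne (hsp (j := j) (by omega)) (hsr hjr)] at hj
    by_cases hjr' : j + 1 = w r
    · rw [hjr', Equiv.symm_apply_apply, Equiv.swap_apply_right] at hj
      rw [hjr', Equiv.symm_apply_apply] at h1 h2
      exact hno (w.symm j) hj (by omega) (by simp; omega) (by simp; omega)
    · rw [Equiv.swap_apply_of_ne_of_ne (hsp (by omega)) (hsr hjr')] at hj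
      omega

end TransitionSystems

namespace TransitionSystems

open Finset

/-! ### Realizing rank functions by permutations -/

section Realize

variable {ρ : ℕ → ℕ → ℕ}

open Classical in
/-- The column of the one in row `i` of the matrix with rank function `ρ`. It is chosen outside the
first `n` columns if this row has no one in these columns. -/
noncomputable def jumpColumn (ρ : ℕ → ℕ → ℕ) (n i : ℕ) : ℕ :=
  if h : ∃ j, j < n ∧ ρ (i + 1) (j + 1) = ρ i (j + 1) + 1 then Nat.find h else n + i

theorem rank_succ_jumpColumn (hρ : IsRankFn ρ) {n : ℕ} (i : ℕ) {b : ℕ} (hb : b ≤ n) :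
    ρ (i + 1) b = ρ i b + if jumpColumn ρ n i < b then 1 else 0 := by
  classical
  have h1 := hρ.mono_left i b
  have h2 := hρ.step_left i b
  unfold jumpColumn
  split_ifs with h3 h4 h4
  · obtain ⟨h5, h6⟩ := Nat.find_spec h3
    have := hρ.supermodular' (a := i) (a' := i + 1) (b := Nat.find h3 + 1) (b' := b)
      (by omega) (by omega)
    omega
  · by_contra h5
    have hb0 : b ≠ 0 := by rintro rfl; simp [hρ.zero_right] at h5
    have := Nat.find_min' h3 (m := b - 1) ⟨by omega, by
      rw [show b - 1 + 1 = b by omega]; omega⟩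
    omega
  · omega
  · by_contra h5
    have hb0 : b ≠ 0 := by rintro rfl; simp [hρ.zero_right] at h5
    exact h3 ⟨b - 1, by omega, by rw [show b - 1 + 1 = b by omega]; omega⟩

theorem jumpColumn_lt {n : ℕ} (i : ℕ) : jumpColumn ρ n i < n ∨ jumpColumn ρ n i = n + i := by
  classical
  unfold jumpColumn
  split_ifs with h
  · exact Or.inl (Nat.find_spec h).1
  · exact Or.inr rfl

theorem jumpColumn_ne (hρ : IsRankFn ρ) {n i i' : ℕ} (hi : i < i') :
    jumpColumn ρ n i ≠ jumpColumn ρ n i' := by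
  intro h
  rcases jumpColumn_lt (ρ := ρ) (n := n) i with h1 | h1
  · have e1 := rank_succ_jumpColumn hρ (n := n) i (b := jumpColumn ρ n i) h1.le
    have e2 := rank_succ_jumpColumn hρ (n := n) i (b := jumpColumn ρ n i + 1) h1
    have e3 := rank_succ_jumpColumn hρ (n := n) i' (b := jumpColumn ρ n i) h1.le
    have e4 := rank_succ_jumpColumn hρ (n := n) i' (b := jumpColumn ρ n i + 1) h1
    rw [← h] at e3 e4
    rw [if_neg (by omega)] at e1 e3
    rw [if_pos (by omega)] at e2 e4
    have := hρ.supermodular' (a := i + 1) (a' := i') (b := jumpColumn ρ n i)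
      (b' := jumpColumn ρ n i + 1) (by omega) (by omega)
    have := hρ.step_right (i' + 1) (jumpColumn ρ n i)
    have := hρ.mono_right i (jumpColumn ρ n i)
    omega
  · rcases jumpColumn_lt (ρ := ρ) (n := n) i' with h2 | h2 <;> omega

theorem exists_perm_of_isRankFn (hρ : IsRankFn ρ) (m n : ℕ) :
    ∃ w : Equiv.Perm ℕ, (∀ i, m + n ≤ i → w i = i) ∧
      ∀ a b, a ≤ m → b ≤ n → permRank w a b = ρ a b := by
  classical
  let s : Finset (Fin (m + n)) := univ.filter fun i => i.1 < m
  let f : Fin (m + n) → ℕ := fun i => jumpColumn ρ n i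
  have hf : s.image f ⊆ range (m + n) := by
    intro x hx
    obtain ⟨i, hi, rfl⟩ := mem_image.1 hx
    have hi : i.1 < m := by simpa [s] using hi
    rw [mem_range]
    rcases jumpColumn_lt (ρ := ρ) (n := n) i.1 with h | h <;> simp only [f] <;> omega
  have hinj : Set.InjOn f s := by
    intro i _ j _ hij
    by_contra hne
    rcases lt_or_gt_of_ne (fun h => hne (Fin.ext h)) with h | h
    · exact jumpColumn_ne hρ h hij
    · exact jumpColumn_ne hρ h hij.symm
  obtain ⟨g, hg⟩ := Finset.exists_equiv_extend_of_card_eq (t := range (m + n)) (by simp) hf hinj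
  let e : Fin (m + n) ≃ {i // i < m + n} := Fin.equivSubtype
  let g' : Equiv.Perm (Fin (m + n)) :=
    (g.trans (Equiv.subtypeEquivRight fun i => mem_range)).trans e.symm
  refine ⟨g'.extendDomain e, fun i hi =>
    Equiv.Perm.extendDomain_apply_not_subtype _ _ (by omega), ?_⟩
  have hval : ∀ i, i < m → g'.extendDomain e i = jumpColumn ρ n i := by
    intro i hi
    have hi' : i < m + n := by omega
    rw [Equiv.Perm.extendDomain_apply_subtype g' e (b := i) hi']
    have := hg ⟨i, hi'⟩ (by simp [s, hi])
    simpa [g', e, f] using this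
  intro a b ha hb
  induction a with
  | zero => rw [permRank_zero_left, hρ.zero_left]
  | succ a ih =>
    rw [permRank_succ_left, ih (by omega), rank_succ_jumpColumn hρ a hb, hval a (by omega)]

theorem permRank_le_left (w : Equiv.Perm ℕ) (a b : ℕ) : permRank w a b ≤ a :=
  (card_filter_le _ _).trans (card_range a).le

/-- Sorting a descent `i` does not change the rank function outside row `i + 1`. -/
theorem permRank_swap_descent {w : Equiv.Perm ℕ} {i : ℕ} (hi : w (i + 1) < w i) :
    (∀ a b, permRank w a b ≤ permRank (w * Equiv.swap i (i + 1)) a b) ∧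
    (∀ a b, a ≠ i + 1 → permRank (w * Equiv.swap i (i + 1)) a b = permRank w a b) ∧
    permRank w (i + 1) (w (i + 1) + 1) <
      permRank (w * Equiv.swap i (i + 1)) (i + 1) (w (i + 1) + 1) := by
  have h := permRank_mul_swap (w := w * Equiv.swap i (i + 1)) (Nat.lt_succ_self i)
    (by simpa using hi)
  simp only [mul_assoc, Equiv.swap_mul_self, mul_one] at h
  refine ⟨fun a b => by have := h a b; omega, fun a b ha => ?_, ?_⟩
  · have := h a b
    rw [if_neg (by omega)] at this
    omega
  · have := h (i + 1) (w (i + 1) + 1)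
    rw [if_pos (by simp; omega)] at this
    omega

theorem bound_swap_descent {w : Equiv.Perm ℕ} {i N : ℕ} (hN : ∀ k, N ≤ k → w k = k)
    (hi : w (i + 1) < w i) {k : ℕ} (hk : N ≤ k) : (w * Equiv.swap i (i + 1)) k = k := by
  have hiN : i + 1 < N := by
    by_contra h
    have h1 := hN (i + 1) (by omega)
    have h2 := w.injective (hN (w i) (by omega))
    omega
  rw [Equiv.Perm.mul_apply, Equiv.swap_apply_of_ne_of_ne (by omega) (by omega), hN k hk]

/-- Every rank function is, on the window of size `m × n`, that of a permutation in `SInf m n`: a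
permutation of largest rank function among those with the given values on the window. -/
theorem exists_mem_SInf_of_isRankFn (hρ : IsRankFn ρ) (m n : ℕ) :
    ∃ w ∈ SInf m n, ∀ a b, a ≤ m → b ≤ n → permRank w a b = ρ a b := by
  classical
  let W : Set (Equiv.Perm ℕ) := {w | (∀ i, m + n ≤ i → w i = i) ∧
      ∀ a b, a ≤ m → b ≤ n → permRank w a b = ρ a b}
  let N := m + n
  let box := range (N + 1) ×ˢ range (N + 1)
  let μ : Equiv.Perm ℕ → ℕ := fun w => ∑ x ∈ box, (N - permRank w x.1 x.2)
  have hex : ∃ k, ∃ w ∈ W, μ w = k := by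
    obtain ⟨w, hw⟩ := exists_perm_of_isRankFn hρ m n
    exact ⟨μ w, w, hw, rfl⟩
  obtain ⟨w, hw, hμ⟩ := Nat.find_spec hex
  have hmin : ∀ z ∈ W, μ w ≤ μ z := fun z hz => hμ ▸ Nat.find_min' hex ⟨z, hz, rfl⟩
  have hmax : ∀ z ∈ W, (∀ a b, permRank w a b ≤ permRank z a b) → ∀ a b, a ≤ N → b ≤ N →
      ¬ permRank w a b < permRank z a b := by
    intro z hz hle a b ha hb hlt
    refine absurd (hmin z hz) (not_le.2 ?_)
    refine sum_lt_sum (fun x _ => Nat.sub_le_sub_left (hle x.1 x.2) N)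
      ⟨(a, b), by simp [box]; omega, ?_⟩
    have := permRank_le_left z a b
    simp only
    omega
  have hsymmN : ∀ {w : Equiv.Perm ℕ}, (∀ k, N ≤ k → w k = k) → ∀ k, N ≤ k → w.symm k = k :=
    fun h k hk => by rw [Equiv.symm_apply_eq, h k hk]
  have hltN : ∀ {w : Equiv.Perm ℕ}, (∀ k, N ≤ k → w k = k) → ∀ k, w (k + 1) < w k →
      k + 1 ≤ N ∧ w (k + 1) + 1 ≤ N := by
    intro w h k hk
    have : k + 1 < N := by
      by_contra h'
      have h1 := h (k + 1) (by omega)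
      have h2 := w.injective (h (w k) (by omega))
      omega
    refine ⟨this.le, ?_⟩
    by_contra h'
    have h2 := w.injective (h (w (k + 1)) (by omega))
    omega
  refine ⟨w, ⟨?_, ?_, ?_⟩, hw.2⟩
  · refine (Set.finite_lt_nat N).subset fun i hi => ?_
    by_contra h
    exact hi (hw.1 i (not_lt.1 h))
  · intro i hi
    by_contra him
    obtain ⟨h1, h2, h3⟩ := permRank_swap_descent hi
    refine hmax _ ⟨fun k hk => bound_swap_descent hw.1 hi hk, fun a b ha hb => ?_⟩ h1 _ _
      (hltN hw.1 i hi).1 (hltN hw.1 i hi).2 h3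
    rw [h2 a b (by omega), hw.2 a b ha hb]
  · intro j hj
    by_contra hjn
    obtain ⟨h1, h2, h3⟩ := permRank_swap_descent hj
    have hs := hsymmN hw.1
    have e : ∀ a b, permRank (w.symm * Equiv.swap j (j + 1)).symm a b =
        permRank (w.symm * Equiv.swap j (j + 1)) b a := fun a b => permRank_symm _ _ _
    refine hmax (w.symm * Equiv.swap j (j + 1)).symm
      ⟨hsymmN fun k hk => bound_swap_descent hs hj hk, fun a b ha hb => ?_⟩
      (fun a b => by rw [e, ← permRank_symm]; exact h1 b a) _ _
      (hltN hs j hj).2 (hltN hs j hj).1 (by rw [e, ← permRank_symm]; exact h3)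
    rw [e, h2 b a (by omega), permRank_symm, hw.2 a b ha hb]

end Realize

/-! ### Antidiagonal chains -/

/-- The set `D` contains an antidiagonal of size `k`, in rows `< a` and columns `< b`. Its positions
are listed from the northeast to the southwest; the values of `r` and `c` from `k` on are
irrelevant. -/
def HasAntidiagonal (D : Set (ℕ × ℕ)) (a b k : ℕ) : Prop :=
  ∃ r c : ℕ → ℕ, (∀ t, t < k → (r t, c t) ∈ D ∧ r t < a ∧ c t < b) ∧
    ∀ t t', t < t' → t' < k → r t < r t' ∧ c t' < c t

variable {D : Set (ℕ × ℕ)}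

theorem HasAntidiagonal.le {a b k : ℕ} (h : HasAntidiagonal D a b k) : k ≤ a := by
  obtain ⟨r, c, h1, h2⟩ := h
  have : ∀ t, t < k → t ≤ r t := by
    intro t
    induction t with
    | zero => intro _; omega
    | succ t ih => intro ht; have := ih (by omega); have := (h2 t (t + 1) (by omega) ht).1; omega
  by_contra hk
  have h3 := this a (by omega)
  have h4 := (h1 a (by omega)).2.1
  omega

theorem HasAntidiagonal.mono {a b k a' b' k' : ℕ} (h : HasAntidiagonal D a b k) (ha : a ≤ a')
    (hb : b ≤ b') (hk : k' ≤ k) : HasAntidiagonal D a' b' k' := by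
  obtain ⟨r, c, h1, h2⟩ := h
  refine ⟨r, c, fun t ht => ?_, fun t t' h3 h4 => h2 t t' h3 (by omega)⟩
  have := h1 t (by omega)
  exact ⟨this.1, by omega, by omega⟩

open Classical in
/-- The largest size of an antidiagonal in `D`, in rows `< a` and columns `< b`. -/
noncomputable def chainRank (D : Set (ℕ × ℕ)) (a b : ℕ) : ℕ := Nat.findGreatest (HasAntidiagonal D a b) a

theorem hasAntidiagonal_zero (D : Set (ℕ × ℕ)) (a b : ℕ) : HasAntidiagonal D a b 0 :=
  ⟨id, id, by simp, by simp⟩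

theorem le_chainRank_iff {a b k : ℕ} : k ≤ chainRank D a b ↔ HasAntidiagonal D a b k := by
  classical
  constructor
  · intro h
    exact (Nat.findGreatest_spec (P := HasAntidiagonal D a b) (Nat.zero_le a)
      (hasAntidiagonal_zero D a b)).mono le_rfl le_rfl h
  · intro h
    exact Nat.le_findGreatest h.le h

/-- Given antidiagonals `T` and `W` of the same size, of which `T` uses the last row and `W` the
last column, either an initial part of `W` can be followed by a final part of `T` so that the result
has size one more, or an initial part of `T` can be followed by a final part of `W`, avoiding both
the last row and the last column. -/
theorem HasAntidiagonal.exchange {a b k : ℕ} (hT : HasAntidiagonal D (a + 1) b (k + 1))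
    (hW : HasAntidiagonal D a (b + 1) (k + 1)) (hno : ¬ HasAntidiagonal D a b (k + 1)) :
    HasAntidiagonal D (a + 1) (b + 1) (k + 2) := by
  obtain ⟨rT, cT, T1, T2⟩ := hT
  obtain ⟨rW, cW, W1, W2⟩ := hW
  have hcross : ∃ i, i ≤ k ∧ rW i < rT i ∧ cT i < cW i := by
    by_contra! hcon
    have hW0 : b ≤ cW 0 := by
      by_contra h
      refine hno ⟨rW, cW, fun t ht => ⟨(W1 t ht).1, (W1 t ht).2.1, ?_⟩, W2⟩
      rcases Nat.eq_zero_or_pos t with rfl | h0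
      · omega
      · have := (W2 0 t h0 ht).2; omega
    have hTk : a ≤ rT k := by
      by_contra h
      refine hno ⟨rT, cT, fun t ht => ⟨(T1 t ht).1, ?_, (T1 t ht).2.2⟩, T2⟩
      rcases Nat.lt_succ_iff_lt_or_eq.1 ht with h0 | rfl
      · have := (T2 t k h0 (by omega)).1; omega
      · omega
    have key : ∀ i, i ≤ k → cT i < cW i ∧ rT i ≤ rW i := by
      intro i
      induction i with
      | zero =>
        intro h
        have h1 := (T1 0 (by omega)).2.2
        have h2 : cT 0 < cW 0 := by omega
        refine ⟨h2, ?_⟩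
        by_contra h3
        have := hcon 0 h (by omega)
        omega
      | succ i ih =>
        intro h
        obtain ⟨ih1, ih2⟩ := ih (by omega)
        have h1 := T2 i (i + 1) (by omega) (by omega)
        have h2 := W2 i (i + 1) (by omega) (by omega)
        have h3 : cT (i + 1) < cW (i + 1) := by
          by_contra h3
          refine hno ⟨fun t => if t ≤ i then rT t else rW t,
            fun t => if t ≤ i then cT t else cW t, fun t ht => ?_, fun t t' h4 h5 => ?_⟩
          · by_cases hti : t ≤ i
            · simp only [hti, if_true]
              have h4 := T1 t ht
              have h5 := T2 t (i + 1) (by omega) (by omega)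
              have h6 := T1 (i + 1) (by omega)
              exact ⟨h4.1, by omega, h4.2.2⟩
            · simp only [hti, if_false]
              have h4 := W1 t ht
              have h5 := W2 0 t (by omega) ht
              have h6 := W1 0 (by omega)
              exact ⟨h4.1, h4.2.1, by omega⟩
          · by_cases hti : t' ≤ i
            · simp only [hti, show t ≤ i by omega, if_true]
              exact T2 t t' h4 h5
            by_cases hti' : t ≤ i
            · simp only [hti, hti', if_true, if_false]
              have h6 : rT t ≤ rT i ∧ cT i ≤ cT t := by
                rcases hti'.lt_or_eq with h | rfl
                · have := T2 t i h (by omega); omega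
                · omega
              have h7 : rW (i + 1) ≤ rW t' ∧ cW t' ≤ cW (i + 1) := by
                rcases (show i + 1 ≤ t' by omega).lt_or_eq with h | rfl
                · have := W2 (i + 1) t' h h5; omega
                · omega
              omega
            · simp only [hti, hti', if_false]
              exact W2 t t' h4 h5
        refine ⟨h3, ?_⟩
        by_contra h4
        have := hcon (i + 1) h (by omega)
        omega
    have h1 := (key k le_rfl).2
    have h2 := (W1 k (by omega)).2.1
    omega
  obtain ⟨i, hik, hr, hc⟩ := hcross
  refine ⟨fun t => if t ≤ i then rW t else rT (t - 1),
    fun t => if t ≤ i then cW t else cT (t - 1), fun t ht => ?_, fun t t' h4 h5 => ?_⟩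
  · by_cases hti : t ≤ i
    · simp only [hti, if_true]
      have := W1 t (by omega)
      exact ⟨this.1, by omega, by omega⟩
    · simp only [hti, if_false]
      have := T1 (t - 1) (by omega)
      exact ⟨this.1, by omega, by omega⟩
  · by_cases hti : t' ≤ i
    · simp only [hti, show t ≤ i by omega, if_true]
      exact W2 t t' h4 (by omega)
    by_cases hti' : t ≤ i
    · simp only [hti, hti', if_true, if_false]
      have h6 : rW t ≤ rW i ∧ cW i ≤ cW t := by
        rcases hti'.lt_or_eq with h | rfl
        · have := W2 t i h (by omega); omega
        · omega
      have h7 : rT i ≤ rT (t' - 1) ∧ cT (t' - 1) ≤ cT i := by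
        rcases (show i ≤ t' - 1 by omega).lt_or_eq with h | h
        · have := T2 i (t' - 1) h (by omega); omega
        · rw [← h]; omega
      omega
    · simp only [hti, hti', if_false]
      exact T2 (t - 1) (t' - 1) (by omega) (by omega)

theorem chainRank_isRankFn (D : Set (ℕ × ℕ)) : IsRankFn (chainRank D) := by
  have hmono : ∀ {a b a' b'}, a ≤ a' → b ≤ b' → chainRank D a b ≤ chainRank D a' b' :=
    fun ha hb => le_chainRank_iff.2 ((le_chainRank_iff.1 le_rfl).mono ha hb le_rfl)
  have hleft : ∀ a b, chainRank D (a + 1) b ≤ chainRank D a b + 1 := by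
    intro a b
    rcases Nat.eq_zero_or_pos (chainRank D (a + 1) b) with h | h
    · omega
    suffices chainRank D (a + 1) b - 1 ≤ chainRank D a b by omega
    obtain ⟨r, c, h1, h2⟩ := le_chainRank_iff.1 (le_refl (chainRank D (a + 1) b))
    refine le_chainRank_iff.2 ⟨r, c, fun t ht => ?_, fun t t' h3 h4 => h2 t t' h3 (by omega)⟩
    have h3 := h1 t (by omega)
    have h4 := h2 t _ ht (by omega)
    have h5 := h1 (chainRank D (a + 1) b - 1) (by omega)
    exact ⟨h3.1, by omega, h3.2.2⟩
  have hright : ∀ a b, chainRank D a (b + 1) ≤ chainRank D a b + 1 := by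
    intro a b
    rcases Nat.eq_zero_or_pos (chainRank D a (b + 1)) with h | h
    · omega
    suffices chainRank D a (b + 1) - 1 ≤ chainRank D a b by omega
    obtain ⟨r, c, h1, h2⟩ := le_chainRank_iff.1 (le_refl (chainRank D a (b + 1)))
    refine le_chainRank_iff.2 ⟨fun t => r (t + 1), fun t => c (t + 1), fun t ht => ?_,
      fun t t' h3 h4 => h2 (t + 1) (t' + 1) (by omega) (by omega)⟩
    have h3 := h1 (t + 1) (by omega)
    have h4 := h2 0 (t + 1) (by omega) (by omega)
    have h5 := h1 0 (by omega)
    exact ⟨h3.1, h3.2.1, show c (t + 1) < b by omega⟩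
  refine ⟨fun b => ?_, fun a => ?_, fun a b => hmono (by omega) le_rfl,
    fun a b => hmono le_rfl (by omega), hleft, hright, fun a b => ?_⟩
  · have := (le_chainRank_iff.1 (le_refl (chainRank D 0 b))).le
    omega
  · by_contra h
    obtain ⟨r, c, h1, -⟩ := le_chainRank_iff.1 (le_refl (chainRank D a 0))
    have := (h1 0 (by omega)).2.2
    omega
  · have h1 := hleft a b
    have h2 := hright a b
    have h3 : chainRank D a (b + 1) ≤ chainRank D (a + 1) (b + 1) := hmono (by omega) le_rfl
    have h4 : chainRank D (a + 1) b ≤ chainRank D (a + 1) (b + 1) := hmono le_rfl (by omega)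
    by_contra hcon
    have h5 := HasAntidiagonal.exchange (D := D) (a := a) (b := b) (k := chainRank D a b)
      (le_chainRank_iff.1 (by omega)) (le_chainRank_iff.1 (by omega))
      (fun h => by have := le_chainRank_iff.2 h; omega)
    have := le_chainRank_iff.2 h5
    omega

end TransitionSystems

namespace TransitionSystems

open Finset Matrix

/-! ### Rank functions of matrices -/

section MatRank

variable {K : Type*} [Field K] {m n : ℕ}

/-- The matrix `M` with all entries replaced by `0` outside the rows `< a` and columns `< b`. -/
def northwest (M : Matrix (Fin m) (Fin n) K) (a b : ℕ) : Matrix (Fin m) (Fin n) K :=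
  Matrix.of fun i j => if i.1 < a ∧ j.1 < b then M i j else 0

/-- The rank of the northwest part of `M` with rows `< a` and columns `< b`. In contrast to
`nwRank`, the bounds are strict and may exceed the size of the matrix. -/
noncomputable def matRank (M : Matrix (Fin m) (Fin n) K) (a b : ℕ) : ℕ := (northwest M a b).rank

theorem northwest_transpose (M : Matrix (Fin m) (Fin n) K) (a b : ℕ) :
    (northwest M a b)ᵀ = northwest Mᵀ b a := by
  ext i j
  simp only [northwest, transpose_apply, of_apply, and_comm]

theorem matRank_transpose (M : Matrix (Fin m) (Fin n) K) (a b : ℕ) :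
    matRank Mᵀ b a = matRank M a b := by
  rw [matRank, ← northwest_transpose, rank_transpose, matRank]

theorem nwRank_eq_matRank (M : Matrix (Fin m) (Fin n) K) (i : Fin m) (j : Fin n) :
    nwRank M i j = matRank M (i + 1) (j + 1) := by
  have e : M.submatrix (fun r : {r : Fin m // r ≤ i} => r.1) (fun c : {c : Fin n // c ≤ j} => c.1) =
      (northwest M (i + 1) (j + 1)).submatrix (fun r : {r : Fin m // r ≤ i} => r.1)
        (fun c : {c : Fin n // c ≤ j} => c.1) := by
    ext ⟨r, hr⟩ ⟨c, hc⟩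
    have hr : r.1 ≤ i.1 := hr
    have hc : c.1 ≤ j.1 := hc
    simp only [northwest, submatrix_apply, of_apply]
    rw [if_pos (by omega)]
  unfold nwRank
  rw [e]
  refine le_antisymm (rank_submatrix_le _ _ _) ?_
  have e2 : northwest M (i + 1) (j + 1) =
      (Matrix.of fun (x : Fin m) (r : {r : Fin m // r ≤ i}) => if x = r.1 then (1 : K) else 0) *
      (northwest M (i + 1) (j + 1)).submatrix (fun r : {r : Fin m // r ≤ i} => r.1)
        (fun c : {c : Fin n // c ≤ j} => c.1) *
      (Matrix.of fun (c : {c : Fin n // c ≤ j}) (y : Fin n) => if y = c.1 then (1 : K) else 0) := by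
    ext x y
    simp only [mul_apply, of_apply, submatrix_apply, ite_mul, one_mul, zero_mul, mul_ite, mul_one,
      mul_zero]
    by_cases hx : x ≤ i
    · by_cases hy : y ≤ j
      · rw [Finset.sum_eq_single ⟨y, hy⟩, if_pos rfl, Finset.sum_eq_single ⟨x, hx⟩, if_pos rfl]
        · intro r _ hr; rw [if_neg]; rintro rfl; exact hr rfl
        · simp
        · intro c _ hc; rw [if_neg]; rintro rfl; exact hc rfl
        · simp
      · rw [Finset.sum_eq_zero]
        · simp only [northwest, of_apply]
          rw [if_neg]
          have : ¬ y.1 ≤ j.1 := hy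
          omega
        · intro c _; rw [if_neg]; rintro rfl; exact hy c.2
    · rw [Finset.sum_eq_zero]
      · simp only [northwest, of_apply]
        rw [if_neg]
        have : ¬ x.1 ≤ i.1 := hx
        omega
      · intro c _
        rw [Finset.sum_eq_zero, ite_self]
        intro r _; rw [if_neg]; rintro rfl; exact hx r.2
  calc matRank M (i + 1) (j + 1) = _ := congrArg rank e2
    _ ≤ _ := (rank_mul_le_left _ _).trans (rank_mul_le_right _ _)

/-- The row `i` of `M`, cut off after its first `b` entries. -/
def truncRow (M : Matrix (Fin m) (Fin n) K) (b : ℕ) (i : Fin m) : Fin n → K :=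
  fun j => if j.1 < b then M i j else 0

/-- The span of the first `a` rows of `M`, cut off after their first `b` entries. -/
def rowSpan (M : Matrix (Fin m) (Fin n) K) (a b : ℕ) : Submodule K (Fin n → K) :=
  Submodule.span K (truncRow M b '' {i | i.1 < a})

theorem matRank_eq_finrank (M : Matrix (Fin m) (Fin n) K) (a b : ℕ) :
    matRank M a b = Module.finrank K (rowSpan M a b) := by
  suffices e : Submodule.span K (Set.range (northwest M a b).row) = rowSpan M a b by
    rw [matRank, rank_eq_finrank_span_row, e]
  rw [rowSpan]
  apply le_antisymm
  · rw [Submodule.span_le]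
    rintro _ ⟨i, rfl⟩
    by_cases hi : i.1 < a
    · refine Submodule.subset_span ⟨i, hi, ?_⟩
      ext j
      simp [truncRow, northwest, row, hi]
    · have : (northwest M a b).row i = 0 := by
        ext j
        simp [northwest, row, hi]
      rw [this]
      exact Submodule.zero_mem _
  · refine Submodule.span_mono ?_
    rintro _ ⟨i, hi, rfl⟩
    refine ⟨i, ?_⟩
    have hi : i.1 < a := hi
    ext j
    simp [truncRow, northwest, row, hi]

theorem rowSpan_succ (M : Matrix (Fin m) (Fin n) K) (p : Fin m) (b : ℕ) :
    rowSpan M (p + 1) b = Submodule.span K {truncRow M b p} ⊔ rowSpan M p b := by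
  rw [rowSpan, rowSpan, ← Submodule.span_union, ← Set.image_singleton, ← Set.image_union]
  congr 2
  ext i
  simp only [Set.mem_ofPred_eq, Set.mem_union, Set.mem_singleton_iff, Fin.ext_iff]
  omega

open Classical in
theorem matRank_succ (M : Matrix (Fin m) (Fin n) K) (p : Fin m) (b : ℕ) :
    matRank M (p + 1) b =
      matRank M p b + if truncRow M b p ∈ rowSpan M p b then 0 else 1 := by
  rw [matRank_eq_finrank, matRank_eq_finrank, rowSpan_succ]
  split_ifs with h
  · rw [sup_eq_right.2 (by simpa using h), add_zero]
  · have h0 : truncRow M b p ≠ 0 := fun h' => h (h' ▸ Submodule.zero_mem _)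
    have h1 := Submodule.finrank_sup_add_finrank_inf_eq (Submodule.span K {truncRow M b p})
      (rowSpan M p b)
    have h2 : Submodule.span K {truncRow M b p} ⊓ rowSpan M p b = ⊥ :=
      disjoint_iff.1 ((Submodule.disjoint_span_singleton' h0).2 h).symm
    rw [h2, finrank_bot, finrank_span_singleton h0] at h1
    omega

theorem matRank_succ_of_le (M : Matrix (Fin m) (Fin n) K) {a : ℕ} (h : m ≤ a) (b : ℕ) :
    matRank M (a + 1) b = matRank M a b := by
  unfold matRank northwest
  congr 1
  ext i j
  simp only [of_apply]
  congr 1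
  have := i.2
  simp only [eq_iff_iff]
  omega

theorem truncRow_mem_of_le {M : Matrix (Fin m) (Fin n) K} {p : Fin m} {a b b' : ℕ} (hb : b ≤ b')
    (h : truncRow M b' p ∈ rowSpan M a b') : truncRow M b p ∈ rowSpan M a b := by
  let f : (Fin n → K) →ₗ[K] (Fin n → K) :=
    LinearMap.pi fun j => if j.1 < b then LinearMap.proj j else 0
  have hf : ∀ i, f (truncRow M b' i) = truncRow M b i := by
    intro i
    ext j
    simp only [f, LinearMap.pi_apply, truncRow]
    split_ifs with h1
    · simp [truncRow, show j.1 < b' by omega]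
    · simp
  have h1 := Submodule.mem_map_of_mem (f := f) h
  rw [hf, rowSpan, Submodule.map_span, ← Set.image_comp] at h1
  have e : f ∘ truncRow M b' = truncRow M b := funext hf
  rwa [e] at h1

theorem matRank_isRankFn (M : Matrix (Fin m) (Fin n) K) : IsRankFn (matRank M) := by
  classical
  have hz : ∀ {m n : ℕ} (M : Matrix (Fin m) (Fin n) K) b, matRank M 0 b = 0 := by
    intro m n M b
    rw [matRank, show northwest M 0 b = 0 by ext i j; simp [northwest], rank_zero]
  have hmono : ∀ {m n : ℕ} (M : Matrix (Fin m) (Fin n) K) a b,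
      matRank M a b ≤ matRank M (a + 1) b := by
    intro m n M a b
    rcases lt_or_ge a m with h | h
    · have := matRank_succ M ⟨a, h⟩ b
      simp only at this
      omega
    · rw [matRank_succ_of_le M h]
  have hstep : ∀ {m n : ℕ} (M : Matrix (Fin m) (Fin n) K) a b,
      matRank M (a + 1) b ≤ matRank M a b + 1 := by
    intro m n M a b
    rcases lt_or_ge a m with h | h
    · have := matRank_succ M ⟨a, h⟩ b
      simp only at this
      split_ifs at this <;> omega
    · rw [matRank_succ_of_le M h]; omega
  refine ⟨hz M, fun a => ?_, hmono M, fun a b => ?_, hstep M, fun a b => ?_, fun a b => ?_⟩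
  · rw [← matRank_transpose]; exact hz _ _
  · rw [← matRank_transpose, ← matRank_transpose M]; exact hmono _ _ _
  · rw [← matRank_transpose, ← matRank_transpose M]; exact hstep _ _ _
  · rcases lt_or_ge a m with h | h
    · have h1 := matRank_succ M ⟨a, h⟩ b
      have h2 := matRank_succ M ⟨a, h⟩ (b + 1)
      have h3 := truncRow_mem_of_le (M := M) (p := ⟨a, h⟩) (a := a) (Nat.le_succ b)
      simp only at h1 h2
      split_ifs at h1 h2 <;> first | omega | tauto
    · rw [matRank_succ_of_le M h, matRank_succ_of_le M h]; omega

theorem nwRank_le_iff {M w : Matrix (Fin m) (Fin n) K} :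
    (∀ i j, nwRank M i j ≤ nwRank w i j) ↔
      ∀ a b, a ≤ m → b ≤ n → matRank M a b ≤ matRank w a b := by
  constructor
  · intro h a b ha hb
    refine (matRank_isRankFn M).le_of_window (fun i j => ?_) ha hb
    rw [← nwRank_eq_matRank, ← nwRank_eq_matRank]
    exact h i j
  · intro h i j
    rw [nwRank_eq_matRank, nwRank_eq_matRank]
    exact h _ _ i.2 j.2

theorem truncRow_permMatrix (w : Equiv.Perm ℕ) (b : ℕ) (i : Fin m) (j : Fin n) :
    truncRow (permMatrix K m n w) b i j = if w i = j ∧ j.1 < b then 1 else 0 := by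
  simp only [truncRow, permMatrix, of_apply]
  split_ifs <;> first | rfl | tauto

theorem matRank_permMatrix (w : Equiv.Perm ℕ) {a b : ℕ} (ha : a ≤ m) (hb : b ≤ n) :
    matRank (permMatrix K m n w) a b = permRank w a b := by
  classical
  induction a with
  | zero => rw [(matRank_isRankFn _).zero_left, permRank_zero_left]
  | succ a ih =>
    have h1 := matRank_succ (permMatrix K m n w) ⟨a, ha⟩ b
    simp only at h1
    rw [h1, permRank_succ_left, ih (by omega)]
    congr 1
    by_cases hw : w a < b
    · rw [if_pos hw, if_neg]
      intro hmem
      -- all rows above row `a` vanish in column `w a`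
      have hle : rowSpan (permMatrix K m n w) a b ≤
          LinearMap.ker (LinearMap.proj (R := K) (φ := fun _ : Fin n => K) ⟨w a, by omega⟩) := by
        rw [rowSpan, Submodule.span_le]
        rintro _ ⟨i, hi, rfl⟩
        have hi : i.1 < a := hi
        rw [SetLike.mem_coe, LinearMap.mem_ker, LinearMap.proj_apply, truncRow_permMatrix, if_neg]
        intro h
        have := w.injective h.1
        omega
      have := hle hmem
      rw [LinearMap.mem_ker, LinearMap.proj_apply, truncRow_permMatrix, if_pos ⟨rfl, hw⟩] at this
      exact one_ne_zero this
    · rw [if_neg hw, if_pos]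
      convert Submodule.zero_mem _
      ext j
      rw [truncRow_permMatrix, if_neg]
      · rfl
      · simp only; omega

end MatRank

/-! ### Minors -/

section Minors

variable {K : Type*} [Field K] {m n : ℕ}

theorem exists_linearIndependent_rows {ι : Type*} [Fintype ι] (A : Matrix (Fin m) ι K) {k : ℕ}
    (hk : k ≤ A.rank) : ∃ (R : Finset (Fin m)) (hR : R.card = k),
      LinearIndependent K (A.submatrix (R.orderEmbOfFin hR) id).row := by
  classical
  obtain ⟨κ, f, hf, hspan, hli⟩ := exists_linearIndependent' K A.row
  have : Finite κ := Finite.of_injective f hf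
  have : Fintype κ := Fintype.ofFinite κ
  have hcard : k ≤ (univ.image f).card := by
    rw [card_image_of_injective _ hf, card_univ, ← finrank_span_eq_card hli, hspan,
      ← rank_eq_finrank_span_row]
    exact hk
  obtain ⟨R, hRs, hR⟩ := exists_subset_card_eq hcard
  refine ⟨R, hR, ?_⟩
  have hg : ∀ t, ∃ x, f x = R.orderEmbOfFin hR t := by
    intro t
    have := hRs (R.orderEmbOfFin_mem hR t)
    simpa using this
  choose g hg using hg
  have hginj : Function.Injective g := by
    intro s t h
    apply (R.orderEmbOfFin hR).injective
    rw [← hg, ← hg, h]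
  have e : (A.submatrix (R.orderEmbOfFin hR) id).row = (A.row ∘ f) ∘ g := by
    ext t x
    simp only [Function.comp_apply, hg]
    rfl
  rw [e]
  exact hli.comp g hginj

theorem le_matRank_iff {M : Matrix (Fin m) (Fin n) K} {a b k : ℕ} :
    k ≤ matRank M a b ↔ ∃ (R : Finset (Fin m)) (S : Finset (Fin n)) (hR : R.card = k)
      (hS : S.card = k), (∀ r ∈ R, r.1 < a) ∧ (∀ c ∈ S, c.1 < b) ∧
      (M.submatrix (R.orderEmbOfFin hR) (S.orderEmbOfFin hS)).det ≠ 0 := by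
  have hsub : ∀ (R : Finset (Fin m)) (S : Finset (Fin n)) (hR : R.card = k) (hS : S.card = k),
      (∀ r ∈ R, r.1 < a) → (∀ c ∈ S, c.1 < b) →
      M.submatrix (R.orderEmbOfFin hR) (S.orderEmbOfFin hS) =
      (northwest M a b).submatrix (R.orderEmbOfFin hR) (S.orderEmbOfFin hS) := by
    intro R S hR hS h1 h2
    ext s t
    simp only [submatrix_apply, northwest, of_apply]
    rw [if_pos ⟨h1 _ (R.orderEmbOfFin_mem hR s), h2 _ (S.orderEmbOfFin_mem hS t)⟩]
  constructor
  · intro hk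
    obtain ⟨R, hR, hli⟩ := exists_linearIndependent_rows (northwest M a b) hk
    set B := (northwest M a b).submatrix (R.orderEmbOfFin hR) id with hB
    have hrank : k ≤ Bᵀ.rank := by rw [rank_transpose, hli.rank_matrix, Fintype.card_fin]
    obtain ⟨S, hS, hli'⟩ := exists_linearIndependent_rows Bᵀ hrank
    have hunit := linearIndependent_rows_iff_isUnit.1 hli'
    have h1 : ∀ r ∈ R, r.1 < a := by
      intro r hr
      by_contra hra
      obtain ⟨t, ht⟩ : ∃ t, R.orderEmbOfFin hR t = r := by
        have : r ∈ Set.range (R.orderEmbOfFin hR) := by simpa using hr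
        exact this
      refine hli.ne_zero t ?_
      ext c
      simp [hB, row, northwest, ht, hra]
    have h2 : ∀ c ∈ S, c.1 < b := by
      intro c hc
      by_contra hcb
      obtain ⟨t, ht⟩ : ∃ t, S.orderEmbOfFin hS t = c := by
        have : c ∈ Set.range (S.orderEmbOfFin hS) := by simpa using hc
        exact this
      refine hli'.ne_zero t ?_
      ext r
      simp [hB, row, northwest, ht, hcb]
    refine ⟨R, S, hR, hS, h1, h2, ?_⟩
    rw [hsub R S hR hS h1 h2, ← det_transpose]
    exact ((isUnit_iff_isUnit_det _).1 hunit).ne_zero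
  · rintro ⟨R, S, hR, hS, h1, h2, hdet⟩
    have := rank_of_det_ne_zero hdet
    rw [Fintype.card_fin] at this
    rw [← this, hsub R S hR hS h1 h2]
    exact rank_submatrix_le _ _ _

end Minors

end TransitionSystems

namespace TransitionSystems

open Finset Matrix

/-! ### Rank one perturbations -/

section Perturbation

variable {K : Type*} [Field K] {m n : ℕ}

theorem rank_add_vecMulVec_mulVec (A : Matrix (Fin m) (Fin n) K) (c y : Fin n → K) (t : K)
    (h : 1 + t * (y ⬝ᵥ c) ≠ 0) : (A + t • vecMulVec (A *ᵥ c) y).rank = A.rank := by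
  have e : A + t • vecMulVec (A *ᵥ c) y =
      A * (1 + replicateCol Unit c * replicateRow Unit (t • y)) := by
    rw [Matrix.mul_add, Matrix.mul_one, ← vecMulVec_eq, ← mul_vecMulVec, vecMulVec_smul,
      Matrix.mul_smul]
  rw [e]
  refine rank_mul_eq_left_of_isUnit_det _ _ ?_
  rw [det_one_add_replicateCol_mul_replicateRow, smul_dotProduct, smul_eq_mul]
  exact isUnit_iff_ne_zero.2 h

theorem rank_add_vecMulVec_vecMul (A : Matrix (Fin m) (Fin n) K) (x d : Fin m → K) (t : K)
    (h : 1 + t * (x ⬝ᵥ d) ≠ 0) : (A + t • vecMulVec x (d ᵥ* A)).rank = A.rank := by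
  have := rank_add_vecMulVec_mulVec Aᵀ d x t h
  rw [rank_transpose, ← rank_transpose] at this
  rw [← this]
  congr 1
  ext i j
  simp [vecMulVec_apply, mulVec_transpose, mul_comm]

theorem exists_mulVec_eq_zero (A : Matrix (Fin m) (Fin n) K) {y : Fin n → K}
    (hy : ∀ d, d ᵥ* A ≠ y) : ∃ β, A *ᵥ β = 0 ∧ y ⬝ᵥ β = 1 := by
  have hy' : y ∉ LinearMap.range A.vecMulLinear := by
    rintro ⟨d, hd⟩
    exact hy d hd
  obtain ⟨φ, h1, h2⟩ := Submodule.exists_le_ker_of_notMem hy'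
  have hφ : ∀ v, φ v = v ⬝ᵥ fun j => φ (Pi.single j 1) := by
    intro v
    conv_lhs => rw [pi_eq_sum_univ' v]
    simp [dotProduct, map_sum]
  refine ⟨(φ y)⁻¹ • fun j => φ (Pi.single j 1), ?_, ?_⟩
  · rw [mulVec_smul]
    suffices A *ᵥ (fun j => φ (Pi.single j 1)) = 0 by rw [this, smul_zero]
    ext i
    have : A.row i ∈ LinearMap.range A.vecMulLinear := ⟨Pi.single i 1, by simp [row]⟩
    have := h2 this
    rw [LinearMap.mem_ker, hφ] at this
    exact this
  · rw [dotProduct_smul, ← hφ, smul_eq_mul, inv_mul_cancel₀ h1]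

theorem rank_add_vecMulVec_of_notMem (A : Matrix (Fin m) (Fin n) K) {x : Fin m → K} {y : Fin n → K}
    (hx : ∀ c, A *ᵥ c ≠ x) (hy : ∀ d, d ᵥ* A ≠ y) {t : K} (ht : t ≠ 0) :
    (A + t • vecMulVec x y).rank = A.rank + 1 := by
  obtain ⟨β, hβ1, hβ2⟩ := exists_mulVec_eq_zero A hy
  have hx' : x ∉ LinearMap.range A.mulVecLin := by
    rintro ⟨c, hc⟩
    exact hx c hc
  have hx0 : x ≠ 0 := fun h => hx' (h ▸ Submodule.zero_mem _)
  have h1 := Submodule.finrank_sup_add_finrank_inf_eq (Submodule.span K {x})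
    (LinearMap.range A.mulVecLin)
  have h2 : Submodule.span K {x} ⊓ LinearMap.range A.mulVecLin = ⊥ :=
    disjoint_iff.1 ((Submodule.disjoint_span_singleton' hx0).2 hx').symm
  rw [h2, finrank_bot, finrank_span_singleton hx0] at h1
  have hB : ∀ v, (A + t • vecMulVec x y) *ᵥ v = A *ᵥ v + (t * (y ⬝ᵥ v)) • x := by
    intro v
    rw [add_mulVec, smul_mulVec, vecMulVec_mulVec, op_smul_eq_smul, smul_smul]
  have hBβ : (A + t • vecMulVec x y) *ᵥ β = t • x := by
    rw [hB, hβ1, hβ2, zero_add, mul_one]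
  have h3 : LinearMap.range (A + t • vecMulVec x y).mulVecLin =
      Submodule.span K {x} ⊔ LinearMap.range A.mulVecLin := by
    apply le_antisymm
    · rintro _ ⟨v, rfl⟩
      rw [mulVecLin_apply, hB, add_comm]
      exact Submodule.add_mem_sup
        (Submodule.smul_mem _ _ (Submodule.mem_span_singleton_self x)) ⟨v, rfl⟩
    · apply sup_le
      · rw [Submodule.span_singleton_le_iff_mem]
        refine ⟨t⁻¹ • β, ?_⟩
        rw [mulVecLin_apply, mulVec_smul, hBβ, smul_smul, inv_mul_cancel₀ ht, one_smul]
      · rintro _ ⟨v, rfl⟩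
        refine ⟨v - (y ⬝ᵥ v) • β, ?_⟩
        rw [mulVecLin_apply, mulVecLin_apply, mulVec_sub, mulVec_smul, hBβ, hB, smul_smul,
          mul_comm t, add_sub_cancel_right]
  unfold rank
  rw [h3]
  omega

/-- The vector `x` with all entries replaced by `0` from index `a` on. -/
def cutVec (a : ℕ) (x : Fin m → K) : Fin m → K := fun i => if i.1 < a then x i else 0

theorem northwest_add_smul_vecMulVec (N : Matrix (Fin m) (Fin n) K) (x : Fin m → K) (y : Fin n → K)
    (t : K) (a b : ℕ) : northwest (N + t • vecMulVec x y) a b =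
      northwest N a b + t • vecMulVec (cutVec a x) (cutVec b y) := by
  ext i j
  by_cases hi : i.1 < a <;> by_cases hj : j.1 < b <;>
    simp [northwest, cutVec, vecMulVec_apply, hi, hj]

theorem northwest_mulVec (N : Matrix (Fin m) (Fin n) K) {c : Fin n → K} {b : ℕ}
    (hc : ∀ j : Fin n, b ≤ j.1 → c j = 0) (a : ℕ) :
    northwest N a b *ᵥ c = cutVec a (N *ᵥ c) := by
  ext i
  simp only [mulVec, dotProduct, northwest, cutVec, of_apply]
  split_ifs with hi
  · refine sum_congr rfl fun j _ => ?_
    by_cases hj : j.1 < b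
    · simp [hi, hj]
    · simp [hc j (not_lt.1 hj)]
  · simp [hi]

theorem northwest_mulVec_cutVec (N : Matrix (Fin m) (Fin n) K) (c : Fin n → K) (a b : ℕ) :
    northwest N a b *ᵥ cutVec b c = northwest N a b *ᵥ c := by
  ext i
  simp only [mulVec, dotProduct, northwest, cutVec, of_apply]
  refine sum_congr rfl fun j _ => ?_
  by_cases hj : j.1 < b <;> simp [hj]

theorem truncRow_dotProduct (N : Matrix (Fin m) (Fin n) K) (b : ℕ) (i : Fin m) (c : Fin n → K) :
    truncRow N b i ⬝ᵥ c = (N *ᵥ cutVec b c) i := by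
  simp only [mulVec, dotProduct, truncRow, cutVec]
  refine sum_congr rfl fun j _ => ?_
  by_cases hj : j.1 < b <;> simp [hj]

/-- If row `p`, cut off before column `b`, is not in the span of the rows above it, then some
combination of the first `b` columns has its first nonzero entry in row `p`. -/
theorem exists_mulVec_of_matRank_succ (N : Matrix (Fin m) (Fin n) K) {p : Fin m} {b : ℕ}
    (h : matRank N (p + 1) b = matRank N p b + 1) :
    ∃ c : Fin n → K, (∀ j : Fin n, b ≤ j.1 → c j = 0) ∧ (∀ i < p, (N *ᵥ c) i = 0) ∧
      (N *ᵥ c) p = 1 := by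
  classical
  have h1 : truncRow N b p ∉ rowSpan N p b := by
    intro h'
    rw [matRank_succ, if_pos h'] at h
    omega
  obtain ⟨φ, h2, h3⟩ := Submodule.exists_le_ker_of_notMem h1
  have hφ : ∀ v, φ v = v ⬝ᵥ fun j => φ (Pi.single j 1) := by
    intro v
    conv_lhs => rw [pi_eq_sum_univ' v]
    simp [dotProduct, map_sum]
  refine ⟨cutVec b ((φ (truncRow N b p))⁻¹ • fun j => φ (Pi.single j 1)), fun j hj => ?_,
    fun i hi => ?_, ?_⟩
  · simp [cutVec, not_lt.2 hj]
  · have h4 : truncRow N b i ∈ rowSpan N p b := Submodule.subset_span ⟨i, hi, rfl⟩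
    have h5 := h3 h4
    rw [LinearMap.mem_ker, hφ] at h5
    rw [← truncRow_dotProduct, dotProduct_smul, h5, smul_zero]
  · rw [← truncRow_dotProduct, dotProduct_smul, ← hφ, smul_eq_mul, inv_mul_cancel₀ h2]

/-- If row `p`, cut off before column `b`, is in the span of the rows above it, then no combination
of the first `b` columns has its first nonzero entry in row `p`. -/
theorem northwest_mulVec_ne (N : Matrix (Fin m) (Fin n) K) {p : Fin m} {a b : ℕ}
    (h : matRank N (p + 1) b = matRank N p b) (ha : p.1 < a) {x : Fin m → K}
    (hx0 : ∀ i < p, x i = 0) (hx1 : x p = 1) (c : Fin n → K) :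
    northwest N a b *ᵥ c ≠ cutVec a x := by
  classical
  intro hc
  have h1 : truncRow N b p ∈ rowSpan N p b := by
    by_contra h'
    rw [matRank_succ, if_neg h'] at h
    omega
  rw [← northwest_mulVec_cutVec, northwest_mulVec N (by
    intro j hj; simp [cutVec, not_lt.2 hj])] at hc
  have hval : ∀ i : Fin m, i.1 < a → truncRow N b i ⬝ᵥ c = x i := by
    intro i hi
    have := congrFun hc i
    simp only [cutVec, hi, if_true] at this
    rw [truncRow_dotProduct]
    exact this
  have h2 : ∀ v ∈ rowSpan N p b, v ⬝ᵥ c = 0 := by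
    intro v hv
    induction hv using Submodule.span_induction with
    | mem v hv =>
      obtain ⟨i, hi, rfl⟩ := hv
      have hi : i.1 < p.1 := hi
      rw [hval i (by omega), hx0 i hi]
    | zero => simp
    | add v w _ _ hv hw => rw [add_dotProduct, hv, hw, add_zero]
    | smul t v _ hv => rw [smul_dotProduct, hv, smul_zero]
  have := h2 _ h1
  rw [hval p ha, hx1] at this
  exact one_ne_zero this

theorem dotProduct_cutVec {x d : Fin m → K} {a : ℕ} (h : ∀ i : Fin m, a ≤ i.1 → d i = 0) :
    cutVec a x ⬝ᵥ d = x ⬝ᵥ d := by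
  refine sum_congr rfl fun i _ => ?_
  by_cases hi : i.1 < a
  · simp [cutVec, hi]
  · simp [h i (not_lt.1 hi)]

/-- The vector `x` used to perturb a matrix with the rank function of `v`, where the row `p` of `v`
has its one in column `s`. If this column belongs to the matrix then `x` is a combination of the
columns up to `s`; otherwise `x` is a unit vector. -/
theorem exists_column (N : Matrix (Fin m) (Fin n) K) (p : Fin m) (s : ℕ)
    (h : s < n → matRank N (p + 1) (s + 1) = matRank N p (s + 1) + 1) :
    ∃ x : Fin m → K, (∀ i < p, x i = 0) ∧ x p = 1 ∧
      ∃ c : Fin n → K, s < n → (∀ j : Fin n, s + 1 ≤ j.1 → c j = 0) ∧ x = N *ᵥ c := by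
  classical
  by_cases hs : s < n
  · obtain ⟨c, h1, h2, h3⟩ := exists_mulVec_of_matRank_succ N (h hs)
    exact ⟨N *ᵥ c, h2, h3, c, fun _ => ⟨h1, rfl⟩⟩
  · exact ⟨Pi.single p 1, fun i hi => Pi.single_eq_of_ne hi.ne _, Pi.single_eq_same _ _, 0,
      fun h => absurd h hs⟩

/-- Every matrix with the rank function of `w t_pr` lies on a line whose points, with finitely many
exceptions, have the rank function of `w`. -/
theorem exists_line {w : Equiv.Perm ℕ} {p r : ℕ} (hpr : p < r) (hw : w p < w r) (hp : p < m)
    (hq : w p < n) {N : Matrix (Fin m) (Fin n) K}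
    (hN : ∀ a b, a ≤ m → b ≤ n → matRank N a b = permRank (w * Equiv.swap p r) a b) :
    ∃ (X : Matrix (Fin m) (Fin n) K) (γ δ : K), ∀ t : K, t ≠ 0 → 1 + t * γ ≠ 0 → 1 + t * δ ≠ 0 →
      ∀ a b, a ≤ m → b ≤ n → matRank (N + t • X) a b = permRank w a b := by
  have hrow : ∀ b, b ≤ n → matRank N (p + 1) b = matRank N p b + if w r < b then 1 else 0 := by
    intro b hb
    rw [hN _ _ hp hb, hN _ _ hp.le hb, permRank_succ_left, Equiv.Perm.mul_apply,
      Equiv.swap_apply_left]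
  have hsymm : (w * Equiv.swap p r).symm (w p) = r := by
    rw [Equiv.symm_apply_eq, Equiv.Perm.mul_apply, Equiv.swap_apply_right]
  have hcol : ∀ a, a ≤ m →
      matRank Nᵀ (w p + 1) a = matRank Nᵀ (w p) a + if r < a then 1 else 0 := by
    intro a ha
    rw [matRank_transpose, matRank_transpose, hN _ _ ha hq, hN _ _ ha hq.le, permRank_succ_right,
      hsymm]
  obtain ⟨x, hx0, hx1, c, hc⟩ := exists_column N ⟨p, hp⟩ (w r) fun h => by
    simp only
    rw [hrow _ h, if_pos (Nat.lt_succ_self _)]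
  obtain ⟨y, hy0, hy1, d, hd⟩ := exists_column Nᵀ ⟨w p, hq⟩ r fun h => by
    simp only
    rw [hcol _ h, if_pos (Nat.lt_succ_self _)]
  refine ⟨vecMulVec x y, y ⬝ᵥ c, x ⬝ᵥ d, fun t ht hγ hδ a b ha hb => ?_⟩
  have hrank := permRank_mul_swap hpr hw a b
  rw [← hN a b ha hb] at hrank
  rw [← hrank, matRank, matRank, northwest_add_smul_vecMulVec]
  by_cases h1 : a ≤ p
  · rw [if_neg (by omega), show cutVec a x = 0 by
      ext i
      by_cases hi : i.1 < a
      · simp [cutVec, hi, hx0 i (Fin.lt_def.2 (lt_of_lt_of_le hi h1))]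
      · simp [cutVec, hi]]
    simp
  by_cases h2 : b ≤ w p
  · rw [if_neg (by omega), show cutVec b y = 0 by
      ext i
      by_cases hi : i.1 < b
      · simp [cutVec, hi, hy0 i (Fin.lt_def.2 (lt_of_lt_of_le hi h2))]
      · simp [cutVec, hi],
      show vecMulVec (cutVec a x) (0 : Fin n → K) = 0 by ext i j; simp [vecMulVec_apply]]
    simp
  by_cases h3 : w r < b
  · obtain ⟨hc0, hc1⟩ := hc (by omega)
    have hc0' : ∀ j : Fin n, b ≤ j.1 → c j = 0 := fun j hj => hc0 j (by omega)
    rw [if_neg (by omega), hc1, ← northwest_mulVec N hc0', add_zero]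
    exact rank_add_vecMulVec_mulVec _ _ _ _ (by rwa [dotProduct_cutVec hc0'])
  by_cases h4 : r < a
  · obtain ⟨hd0, hd1⟩ := hd (by omega)
    have hd0' : ∀ j : Fin m, a ≤ j.1 → d j = 0 := fun j hj => hd0 j (by omega)
    rw [if_neg (by omega), hd1, ← northwest_mulVec Nᵀ hd0', ← northwest_transpose, mulVec_transpose,
      add_zero]
    exact rank_add_vecMulVec_vecMul _ _ _ _ (by rwa [dotProduct_cutVec hd0'])
  · rw [if_pos (by omega)]
    refine rank_add_vecMulVec_of_notMem _ ?_ ?_ ht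
    · exact northwest_mulVec_ne N (p := ⟨p, hp⟩) (by simp [hrow b hb, h3]) (by simp; omega) hx0 hx1
    · intro d
      rw [← mulVec_transpose, northwest_transpose]
      exact northwest_mulVec_ne Nᵀ (p := ⟨w p, hq⟩) (by simp [hcol a ha, h4]) (by simp; omega)
        hy0 hy1 d

end Perturbation

end TransitionSystems

namespace TransitionSystems

open MvPolynomial

/-! ### Ideals of matrix Schubert varieties -/

section MatrixIdeal

variable {K : Type*} [Field K] {m n : ℕ}

/-- The value of a polynomial at a matrix. -/
noncomputable def evalAt (M : Matrix (Fin m) (Fin n) K) : MvPolynomial (Pos m n) K →ₐ[K] K :=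
  aeval fun p : Pos m n => M (ofLex p).1 (ofLex p).2

@[simp]
theorem evalAt_xVar (M : Matrix (Fin m) (Fin n) K) (i : Fin m) (j : Fin n) :
    evalAt M (xVar K i j) = M i j := by
  simp [evalAt, xVar]

theorem mem_matrixIdeal {V : Set (Matrix (Fin m) (Fin n) K)} {g : MvPolynomial (Pos m n) K} :
    g ∈ matrixIdeal V ↔ ∀ M ∈ V, evalAt M g = 0 := by
  rw [matrixIdeal, mem_vanishingIdeal_iff, Set.forall_mem_image]
  rfl

theorem mem_MSV {M w : Matrix (Fin m) (Fin n) K} :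
    M ∈ MSV w ↔ ∀ a b, a ≤ m → b ≤ n → matRank M a b ≤ matRank w a b :=
  nwRank_le_iff

theorem mem_MSV_permMatrix {M : Matrix (Fin m) (Fin n) K} {w : Equiv.Perm ℕ} :
    M ∈ MSV (permMatrix K m n w) ↔ ∀ a b, a ≤ m → b ≤ n → matRank M a b ≤ permRank w a b := by
  rw [mem_MSV]
  refine forall₂_congr fun a b => forall₂_congr fun ha hb => ?_
  rw [matRank_permMatrix w ha hb]

theorem self_mem_MSV (w : Matrix (Fin m) (Fin n) K) : w ∈ MSV w := fun _ _ => le_rfl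

theorem matRank_zero (a b : ℕ) : matRank (0 : Matrix (Fin m) (Fin n) K) a b = 0 := by
  rw [matRank, show northwest (0 : Matrix (Fin m) (Fin n) K) a b = 0 by ext i j; simp [northwest],
    Matrix.rank_zero]

theorem zero_mem_MSV (w : Matrix (Fin m) (Fin n) K) : 0 ∈ MSV w := by
  rw [mem_MSV]
  intro a b _ _
  rw [matRank_zero]
  exact Nat.zero_le _

theorem matrixIdeal_ne_top (w : Matrix (Fin m) (Fin n) K) : matrixIdeal (MSV w) ≠ ⊤ := by
  rw [Ne, Ideal.eq_top_iff_one, mem_matrixIdeal]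
  intro h
  simpa using h 0 (zero_mem_MSV w)

/-- If the ideal of a matrix Schubert variety is maximal then it is the ideal of the origin. -/
theorem eq_zero_of_isMaximal {w : Matrix (Fin m) (Fin n) K}
    (h : (matrixIdeal (MSV w)).IsMaximal) : w = 0 := by
  have h1 : matrixIdeal (MSV w) ≤ matrixIdeal {0} := by
    intro g hg
    rw [mem_matrixIdeal] at hg ⊢
    rintro _ rfl
    exact hg 0 (zero_mem_MSV w)
  have h2 : matrixIdeal ({0} : Set (Matrix (Fin m) (Fin n) K)) ≠ ⊤ := by
    rw [Ne, Ideal.eq_top_iff_one, mem_matrixIdeal]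
    intro h
    simpa using h 0 rfl
  have h3 := h.eq_of_le h2 h1
  ext i j
  have h4 : xVar K i j ∈ matrixIdeal (MSV w) := by
    rw [h3, mem_matrixIdeal]
    rintro _ rfl
    simp
  simpa using mem_matrixIdeal.1 h4 w (self_mem_MSV w)

theorem apply_eq_zero_of_matRank_eq_zero {M : Matrix (Fin m) (Fin n) K} {i : Fin m} {j : Fin n}
    (h : matRank M (i + 1) (j + 1) = 0) : M i j = 0 := by
  rw [matRank_eq_finrank, Submodule.finrank_eq_zero] at h
  have h1 : truncRow M (j + 1) i ∈ rowSpan M (i + 1) (j + 1) :=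
    Submodule.subset_span ⟨i, Nat.lt_succ_self _, rfl⟩
  rw [h, Submodule.mem_bot] at h1
  simpa [truncRow] using congrFun h1 j

theorem MSV_zero : MSV (0 : Matrix (Fin m) (Fin n) K) = {0} := by
  refine Set.Subset.antisymm (fun M hM => ?_) (Set.singleton_subset_iff.2 (zero_mem_MSV 0))
  rw [mem_MSV] at hM
  ext i j
  have h := hM (i + 1) (j + 1) i.2 j.2
  rw [matRank_zero, Nat.le_zero] at h
  exact apply_eq_zero_of_matRank_eq_zero h

theorem isMaximal_zero : (matrixIdeal (MSV (0 : Matrix (Fin m) (Fin n) K))).IsMaximal := by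
  rw [MSV_zero, matrixIdeal, Set.image_singleton]
  infer_instance

/-- The minors of size `k + 1` in the first rows and columns vanish on the matrices of rank at most
`k` there, and conversely. -/
theorem mem_MSV_iff_evalAt {M w : Matrix (Fin m) (Fin n) K} :
    M ∈ MSV w ↔ ∀ (i : Fin m) (j : Fin n) (R : Finset (Fin m)) (S : Finset (Fin n))
      (hR : R.card = 1 + nwRank w i j) (hS : S.card = 1 + nwRank w i j),
      (∀ r ∈ R, r ≤ i) → (∀ c ∈ S, c ≤ j) →
      evalAt M ((genericMatrix K m n).submatrix (R.orderEmbOfFin hR)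
        (S.orderEmbOfFin hS)).det = 0 := by
  have hdet : ∀ {k : ℕ} (r : Fin k → Fin m) (c : Fin k → Fin n),
      evalAt M ((genericMatrix K m n).submatrix r c).det = (M.submatrix r c).det := by
    intro k r c
    rw [AlgHom.map_det]
    congr 1
    ext s t
    simp [genericMatrix]
  simp only [hdet]
  constructor
  · intro h i j R S hR hS h1 h2
    by_contra hne
    have h3 := (le_matRank_iff (M := M) (a := i + 1) (b := j + 1)).2 ⟨R, S, hR, hS,
      fun r hr => Nat.lt_succ_iff.2 (h1 r hr), fun c hc => Nat.lt_succ_iff.2 (h2 c hc), hne⟩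
    rw [← nwRank_eq_matRank] at h3
    have := h i j
    omega
  · intro h i j
    by_contra hlt
    rw [not_le, nwRank_eq_matRank M] at hlt
    obtain ⟨R, S, hR, hS, h1, h2, h3⟩ :=
      (le_matRank_iff (M := M) (a := i + 1) (b := j + 1) (k := 1 + nwRank w i j)).1 (by omega)
    exact h3 (h i j R S hR hS (fun r hr => Nat.lt_succ_iff.1 (h1 r hr))
      fun c hc => Nat.lt_succ_iff.1 (h2 c hc))

/-- Matrix Schubert varieties are cut out by minors. -/
theorem MSV_subset_of_matrixIdeal_le {v w : Matrix (Fin m) (Fin n) K}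
    (h : matrixIdeal (MSV v) ≤ matrixIdeal (MSV w)) : MSV w ⊆ MSV v := by
  intro M hM
  rw [mem_MSV_iff_evalAt]
  intro i j R S hR hS h1 h2
  refine mem_matrixIdeal.1 (h (mem_matrixIdeal.2 fun N hN => ?_)) M hM
  exact mem_MSV_iff_evalAt.1 hN i j R S hR hS h1 h2

theorem nwRank_eq_of_matrixIdeal_eq {v w : Matrix (Fin m) (Fin n) K}
    (h : matrixIdeal (MSV v) = matrixIdeal (MSV w)) (i : Fin m) (j : Fin n) :
    nwRank v i j = nwRank w i j :=
  le_antisymm (MSV_subset_of_matrixIdeal_le h.ge (self_mem_MSV v) i j)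
    (MSV_subset_of_matrixIdeal_le h.le (self_mem_MSV w) i j)

end MatrixIdeal

/-! ### A dense subset of a matrix Schubert variety -/

section Dense

variable {K : Type*} [Field K] [Infinite K] {m n : ℕ}

/-- A polynomial that vanishes on almost all of a line vanishes on all of it. -/
theorem evalAt_eq_zero_of_line {g : MvPolynomial (Pos m n) K} {N X : Matrix (Fin m) (Fin n) K}
    {γ δ : K} (h : ∀ t : K, t ≠ 0 → 1 + t * γ ≠ 0 → 1 + t * δ ≠ 0 → evalAt (N + t • X) g = 0) :
    evalAt N g = 0 := by
  let P : Polynomial K := aeval (fun p : Pos m n => Polynomial.C (N (ofLex p).1 (ofLex p).2) +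
    Polynomial.X * Polynomial.C (X (ofLex p).1 (ofLex p).2)) g
  have hP : ∀ t, P.eval t = evalAt (N + t • X) g := by
    intro t
    rw [← Polynomial.coe_aeval_eq_eval]
    simp only [P]
    rw [← AlgHom.comp_apply, comp_aeval, evalAt]
    congr 2
    ext p
    simp
    exact mul_comm _ _
  have hone : ∀ c : K, (1 + Polynomial.X * Polynomial.C c : Polynomial K) ≠ 0 := by
    intro c h
    simpa using congrArg (Polynomial.eval 0) h
  have hzero : P * (Polynomial.X * ((1 + Polynomial.X * Polynomial.C γ) *
      (1 + Polynomial.X * Polynomial.C δ))) = 0 := by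
    refine Polynomial.funext fun t => ?_
    simp only [Polynomial.eval_mul, Polynomial.eval_X, Polynomial.eval_add, Polynomial.eval_one,
      Polynomial.eval_C, Polynomial.eval_zero]
    by_cases h0 : t = 0
    · simp [h0]
    by_cases h1 : 1 + t * γ = 0
    · simp [h1]
    by_cases h2 : 1 + t * δ = 0
    · simp [h2]
    rw [hP, h t h0 h1 h2, zero_mul]
  have hP0 : P = 0 := (mul_eq_zero.1 hzero).resolve_right
    (mul_ne_zero Polynomial.X_ne_zero (mul_ne_zero (hone γ) (hone δ)))
  have := hP 0
  rw [hP0, zero_smul, add_zero, Polynomial.eval_zero] at this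
  exact this.symm

/-- If a rank function lies below that of `w` on a window but is different from it there, then it
differs at a one of `w`, namely in the first row where the rank functions differ. -/
theorem exists_lt_at_one {ρ : ℕ → ℕ → ℕ} (hρ : IsRankFn ρ) {w : Equiv.Perm ℕ}
    (hle : ∀ a b, a ≤ m → b ≤ n → ρ a b ≤ permRank w a b)
    (hne : ¬ ∀ a b, a ≤ m → b ≤ n → ρ a b = permRank w a b) :
    ∃ p, p < m ∧ w p < n ∧ ρ (p + 1) (w p + 1) < permRank w (p + 1) (w p + 1) := by
  classical
  push Not at hne
  have hex : ∃ a, ∃ b, a ≤ m ∧ b ≤ n ∧ ρ a b ≠ permRank w a b := hne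
  obtain ⟨b, ha, hb, hab⟩ := Nat.find_spec hex
  have hmin : ∀ a, a < Nat.find hex → ∀ b, b ≤ n → ρ a b = permRank w a b := by
    intro a h b hb
    by_contra h'
    exact Nat.find_min hex h ⟨b, by omega, hb, h'⟩
  generalize Nat.find hex = a at *
  cases a with
  | zero => rw [hρ.zero_left, permRank_zero_left] at hab; exact absurd rfl hab
  | succ p =>
    have h1 := hmin p (Nat.lt_succ_self p)
    have h2 := hle (p + 1) b ha hb
    have h3 := h1 b hb
    have h4 := hρ.mono_left p b
    have h5 := permRank_succ_left w p b
    have hwb : w p < b := by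
      by_contra h
      rw [if_neg h] at h5
      omega
    rw [if_pos hwb] at h5
    refine ⟨p, ha, by omega, ?_⟩
    have h6 := permRank_succ_left w p (w p + 1)
    rw [if_pos (Nat.lt_succ_self _)] at h6
    have h7 := h1 (w p + 1) (by omega)
    have h8 := hρ.supermodular' (a := p) (a' := p + 1) (b := w p + 1) (b' := b) (by omega) hwb
    omega

/-- The matrices with the same rank function as `w` are dense in the matrix Schubert variety: by
induction, with `exists_coverPair_le` for finding a smaller variety through a given matrix, and
`exists_line` for moving out of the smaller variety. -/
theorem evalAt_eq_zero_of_rank_eq {w : Equiv.Perm ℕ} (hw : {i | w i ≠ i}.Finite)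
    {g : MvPolynomial (Pos m n) K}
    (hg : ∀ N : Matrix (Fin m) (Fin n) K,
      (∀ a b, a ≤ m → b ≤ n → matRank N a b = permRank w a b) → evalAt N g = 0)
    (M : Matrix (Fin m) (Fin n) K) (hM : ∀ a b, a ≤ m → b ≤ n → matRank M a b ≤ permRank w a b) :
    evalAt M g = 0 := by
  induction hs : ∑ x ∈ Finset.range (m + 1) ×ˢ Finset.range (n + 1), permRank w x.1 x.2
    using Nat.strong_induction_on generalizing w with
  | _ s ih =>
    by_cases heq : ∀ a b, a ≤ m → b ≤ n → matRank M a b = permRank w a b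
    · exact hg M heq
    obtain ⟨p, hp, hq, hlt⟩ := exists_lt_at_one (matRank_isRankFn M) hM heq
    have hwin := (matRank_isRankFn M).window m n
    obtain ⟨r, ⟨hpr, hwr, -⟩, hr⟩ := exists_coverPair_le hwin hw
      (fun a b => (hM _ _ (min_le_right a m) (min_le_right b n)).trans
        (((permRank_isRankFn w).le_left (min_le_left a m) _).trans
          ((permRank_isRankFn w).le_right a (min_le_left b n))))
      (p := p) (by simpa only [min_eq_left (Nat.succ_le_of_lt hp), min_eq_left (Nat.succ_le_of_lt hq)] using hlt)
    refine ih _ ?_ (finite_support_mul_swap hw p r) (fun N hN => ?_) (fun a b ha hb => ?_) rfl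
    · rw [← hs]
      refine Finset.sum_lt_sum (fun x _ => ?_) ⟨(p + 1, w p + 1), ?_, ?_⟩
      · have := permRank_mul_swap hpr hwr x.1 x.2
        omega
      · simp only [Finset.mem_product, Finset.mem_range]
        omega
      · have := permRank_mul_swap hpr hwr (p + 1) (w p + 1)
        rw [if_pos (by omega)] at this
        simp only
        omega
    · obtain ⟨X, γ, δ, h⟩ := exists_line hpr hwr hp hq hN
      exact evalAt_eq_zero_of_line fun t ht hγ hδ => hg _ (h t ht hγ hδ)
    · simpa [min_eq_left ha, min_eq_left hb] using hr a b

theorem colon_xVar_eq {w : Equiv.Perm ℕ} (hw : {i | w i ≠ i}.Finite) {p : Fin m} {q : Fin n}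
    (hpos : ∀ N : Matrix (Fin m) (Fin n) K,
      (∀ a b, a ≤ m → b ≤ n → matRank N a b = permRank w a b) → N p q ≠ 0) :
    (matrixIdeal (MSV (permMatrix K m n w))).colon {xVar K p q} =
      matrixIdeal (MSV (permMatrix K m n w)) := by
  refine le_antisymm (fun g hg => ?_) Ideal.le_colon
  rw [Submodule.mem_colon_singleton, smul_eq_mul, mem_matrixIdeal] at hg
  rw [mem_matrixIdeal]
  intro M hM
  refine evalAt_eq_zero_of_rank_eq hw (fun N hN => ?_) M (mem_MSV_permMatrix.1 hM)
  have := hg N (mem_MSV_permMatrix.2 fun a b ha hb => (hN a b ha hb).le)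
  rw [map_mul, evalAt_xVar] at this
  exact (mul_eq_zero.1 this).resolve_right (hpos N hN)

end Dense

end TransitionSystems

namespace TransitionSystems

open MvPolynomial Finset

/-! ### Initial terms of minors -/

section Antidiagonal

variable {m n k : ℕ}

/-- The exponent vector of the product of the variables in the rows `r t` and columns
`c (σ t)`. -/
noncomputable def permExponent (r : Fin k → Fin m) (c : Fin k → Fin n) (σ : Equiv.Perm (Fin k)) :
    Pos m n →₀ ℕ := ∑ t, Finsupp.single (toLex (r t, c (σ t))) 1

theorem permExponent_apply {r : Fin k → Fin m} (hr : Function.Injective r) (c : Fin k → Fin n)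
    (σ : Equiv.Perm (Fin k)) (t : Fin k) (y : Fin n) :
    permExponent r c σ (toLex (r t, y)) = if c (σ t) = y then 1 else 0 := by
  rw [permExponent, Finsupp.finsetSum_apply, Finset.sum_eq_single t]
  · rw [Finsupp.single_apply]
    simp
  · intro s _ hs
    rw [Finsupp.single_apply, if_neg]
    intro h
    exact hs (hr (Prod.mk.inj (toLex.injective h)).1)
  · simp

theorem permExponent_apply_of_notMem {r : Fin k → Fin m} (c : Fin k → Fin n)
    (σ : Equiv.Perm (Fin k)) {i : Fin m} (hi : ∀ t, r t ≠ i) (y : Fin n) :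
    permExponent r c σ (toLex (i, y)) = 0 := by
  rw [permExponent, Finsupp.finsetSum_apply, Finset.sum_eq_zero]
  intro s _
  rw [Finsupp.single_apply, if_neg]
  intro h
  exact hi s (Prod.mk.inj (toLex.injective h)).1

theorem degree_permExponent (r : Fin k → Fin m) (c : Fin k → Fin n) (σ : Equiv.Perm (Fin k)) :
    (permExponent r c σ).degree = k := by
  simp [permExponent, Finsupp.degree_single]

/-- In a minor, the antidiagonal term is the largest one: compare in the last row where another
term differs from it. -/
theorem permExponent_lt {r : Fin k → Fin m} {c : Fin k → Fin n} (hr : StrictMono r)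
    (hc : StrictMono c) {σ : Equiv.Perm (Fin k)} (hσ : σ ≠ Fin.revPerm) :
    toGrevLex (permExponent r c σ) < toGrevLex (permExponent r c Fin.revPerm) := by
  rw [grevLex_lt_iff]
  refine Or.inr ⟨by rw [degree_permExponent, degree_permExponent], ?_⟩
  have hne : (univ.filter fun t => σ t ≠ t.rev).Nonempty := by
    by_contra h
    rw [not_nonempty_iff_eq_empty, filter_eq_empty_iff] at h
    refine hσ (Equiv.ext fun t => ?_)
    simpa using h (mem_univ t)
  obtain ⟨t, ht, hmax⟩ := exists_max_image _ id hne
  have ht : σ t ≠ t.rev := by simpa using ht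
  have hgt : ∀ s, t < s → σ s = s.rev := by
    intro s hs
    by_contra h
    exact absurd (hmax s (by simpa using h)) (not_le.2 hs)
  have hlt : t.rev < σ t := by
    refine lt_of_le_of_ne ?_ (Ne.symm ht)
    by_contra h
    have h1 : t < (σ t).rev := by rw [← Fin.rev_lt_rev, Fin.rev_rev]; exact not_le.1 h
    have h2 := hgt _ h1
    rw [Fin.rev_rev] at h2
    exact h1.ne' (σ.injective h2)
  refine ⟨toLex (r t, c (σ t)), fun s hs => ?_, ?_⟩
  · obtain ⟨⟨i, y⟩, rfl⟩ := toLex.surjective s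
    by_cases hi : ∃ s, r s = i
    · obtain ⟨s, rfl⟩ := hi
      rw [permExponent_apply hr.injective, permExponent_apply hr.injective, Fin.revPerm_apply]
      rcases Prod.Lex.toLex_lt_toLex.1 hs with h | ⟨h, h'⟩
      · rw [hgt s (hr.lt_iff_lt.1 h)]
      · have h : t = s := hr.injective h
        subst h
        have h' : c (σ t) < y := h'
        rw [if_neg h'.ne, if_neg ((hc hlt).trans h').ne]
    · push Not at hi
      rw [permExponent_apply_of_notMem c _ hi, permExponent_apply_of_notMem c _ hi]
  · rw [permExponent_apply hr.injective, permExponent_apply hr.injective, if_pos rfl,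
      Fin.revPerm_apply, if_neg (hc hlt).ne]
    exact Nat.one_pos

variable {K : Type*} [Field K]

theorem prod_genericMatrix (r : Fin k → Fin m) (c : Fin k → Fin n) (σ : Equiv.Perm (Fin k)) :
    ∏ t, genericMatrix K m n (r t) (c (σ t)) = monomial (permExponent r c σ) 1 := by
  rw [permExponent, monomial_sum_one]
  rfl

theorem adiag_genericMatrix (r : Fin k → Fin m) (c : Fin k → Fin n) :
    adiag ((genericMatrix K m n).submatrix r c) =
      monomial (permExponent r c Fin.revPerm) 1 :=
  prod_genericMatrix r c Fin.revPerm

theorem coeff_det_genericMatrix (r : Fin k → Fin m) (c : Fin k → Fin n) (e : Pos m n →₀ ℕ) :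
    coeff e ((genericMatrix K m n).submatrix r c).det =
      ∑ σ : Equiv.Perm (Fin k), if permExponent r c σ = e then ((σ.sign : ℤ) : K) else 0 := by
  rw [← Matrix.det_transpose, Matrix.det_apply', coeff_sum]
  refine sum_congr rfl fun σ _ => ?_
  simp only [Matrix.transpose_apply, Matrix.submatrix_apply]
  rw [prod_genericMatrix, show ((σ.sign : ℤ) : MvPolynomial (Pos m n) K) = C ((σ.sign : ℤ) : K) by
    simp, coeff_C_mul, coeff_monomial]
  simp

theorem initTerm_det {r : Fin k → Fin m} {c : Fin k → Fin n} (hr : StrictMono r)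
    (hc : StrictMono c) :
    initTerm (grevLex (Pos m n)) ((genericMatrix K m n).submatrix r c).det =
      adiag ((genericMatrix K m n).submatrix r c) := by
  have hcoeff : coeff (permExponent r c Fin.revPerm)
      ((genericMatrix K m n).submatrix r c).det ≠ 0 := by
    rw [coeff_det_genericMatrix, Finset.sum_eq_single Fin.revPerm, if_pos rfl]
    · rcases Int.units_eq_one_or (Equiv.Perm.sign (Fin.revPerm : Equiv.Perm (Fin k))) with h | h <;>
        simp [h]
    · intro σ _ hσ
      rw [if_neg]
      intro h
      have := permExponent_lt hr hc hσ
      rw [h] at this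
      exact lt_irrefl _ this
    · simp
  have hne : ((genericMatrix K m n).submatrix r c).det ≠ 0 := by
    rintro h
    rw [h] at hcoeff
    exact hcoeff (coeff_zero _)
  have hdeg : (grevLex (Pos m n)).degree ((genericMatrix K m n).submatrix r c).det =
      permExponent r c Fin.revPerm := by
    apply (grevLex (Pos m n)).toSyn.injective
    apply le_antisymm
    · rw [MonomialOrder.degree_le_iff]
      intro e he
      rw [mem_support_iff, coeff_det_genericMatrix] at he
      obtain ⟨σ, -, hσ⟩ := exists_ne_zero_of_sum_ne_zero he
      have hσ : permExponent r c σ = e := by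
        by_contra h
        exact hσ (if_neg h)
      rw [← hσ]
      by_cases h : σ = Fin.revPerm
      · rw [h]
      · exact (permExponent_lt hr hc h).le
    · exact MonomialOrder.le_degree (mem_support_iff.2 hcoeff)
  rw [initTerm, if_neg hne, hdeg, adiag_genericMatrix]

/-! ### The antidiagonal ideals -/

/-- The exponent vectors of the generators of `antidiagIdeal w`. -/
def antidiagExponents (w : Matrix (Fin m) (Fin n) K) : Set (Pos m n →₀ ℕ) :=
  {e | ∃ (i : Fin m) (j : Fin n) (R : Finset (Fin m)) (S : Finset (Fin n))
    (hR : R.card = 1 + nwRank w i j) (hS : S.card = 1 + nwRank w i j),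
    (∀ r ∈ R, r ≤ i) ∧ (∀ c ∈ S, c ≤ j) ∧
    e = permExponent (R.orderEmbOfFin hR) (S.orderEmbOfFin hS) Fin.revPerm}

theorem antidiagIdeal_eq_span (w : Matrix (Fin m) (Fin n) K) :
    antidiagIdeal w = Ideal.span ((fun e => monomial e (1 : K)) '' antidiagExponents w) := by
  unfold antidiagIdeal
  congr 1
  ext g
  constructor
  · rintro ⟨i, j, R, S, hR, hS, h1, h2, rfl⟩
    exact ⟨_, ⟨i, j, R, S, hR, hS, h1, h2, rfl⟩, (adiag_genericMatrix _ _).symm⟩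
  · rintro ⟨_, ⟨i, j, R, S, hR, hS, h1, h2, rfl⟩, rfl⟩
    exact ⟨i, j, R, S, hR, hS, h1, h2, (adiag_genericMatrix _ _).symm⟩

theorem antidiagIdeal_le_initIdeal (w : Matrix (Fin m) (Fin n) K) :
    antidiagIdeal w ≤ initIdeal (grevLex (Pos m n)) (matrixIdeal (MSV w)) := by
  rw [antidiagIdeal, Ideal.span_le]
  rintro _ ⟨i, j, R, S, hR, hS, h1, h2, rfl⟩
  rw [← initTerm_det (R.orderEmbOfFin hR).strictMono (S.orderEmbOfFin hS).strictMono]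
  refine Ideal.subset_span ⟨_, ?_, rfl⟩
  exact mem_matrixIdeal.2 fun M hM => mem_MSV_iff_evalAt.1 hM i j R S hR hS h1 h2

theorem antidiagIdeal_ne_top (w : Matrix (Fin m) (Fin n) K) : antidiagIdeal w ≠ ⊤ := by
  have h : antidiagIdeal w ≤ RingHom.ker (evalAt (0 : Matrix (Fin m) (Fin n) K)) := by
    rw [antidiagIdeal, Ideal.span_le]
    rintro _ ⟨i, j, R, S, hR, hS, -, -, rfl⟩
    rw [SetLike.mem_coe, RingHom.mem_ker, adiag, map_prod]
    exact prod_eq_zero (mem_univ ⟨0, by omega⟩) (by simp [genericMatrix])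
  intro h'
  rw [h', top_le_iff] at h
  exact RingHom.ker_ne_top _ h

theorem initTerm_xVar (i : Fin m) (j : Fin n) :
    initTerm (grevLex (Pos m n)) (xVar K i j) = monomial (Finsupp.single (toLex (i, j)) 1) 1 := by
  rw [initTerm, xVar, if_neg (X_ne_zero _), MonomialOrder.degree_X]

/-- The set of positions of the variables that occur in a monomial. -/
def positions (e : Pos m n →₀ ℕ) : Set (ℕ × ℕ) :=
  {x | ∃ (h1 : x.1 < m) (h2 : x.2 < n), e (toLex (⟨x.1, h1⟩, ⟨x.2, h2⟩)) ≠ 0}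

theorem mem_positions {e : Pos m n →₀ ℕ} (i : Fin m) (j : Fin n) :
    (i.1, j.1) ∈ positions e ↔ e (toLex (i, j)) ≠ 0 :=
  ⟨fun ⟨_, _, h⟩ => h, fun h => ⟨i.2, j.2, h⟩⟩

/-- A monomial is a multiple of a generator of `antidiagIdeal w` if and only if its set of positions
contains too long an antidiagonal. -/
theorem exists_antidiagExponent_le_iff {w : Matrix (Fin m) (Fin n) K} {e : Pos m n →₀ ℕ} :
    (∃ e' ∈ antidiagExponents w, e' ≤ e) ↔
      ∃ (i : Fin m) (j : Fin n), matRank w (i + 1) (j + 1) <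
        chainRank (positions e) (i + 1) (j + 1) := by
  constructor
  · rintro ⟨_, ⟨i, j, R, S, hR, hS, h1, h2, rfl⟩, hle⟩
    refine ⟨i, j, ?_⟩
    rw [← nwRank_eq_matRank, ← Nat.succ_le_iff, le_chainRank_iff]
    generalize hk : 1 + nwRank w i j = k at *
    rw [show (nwRank w i j).succ = k by omega]
    refine ⟨fun t => if h : t < k then R.orderEmbOfFin hR ⟨t, h⟩ else 0,
      fun t => if h : t < k then S.orderEmbOfFin hS (Fin.rev ⟨t, h⟩) else 0,
      fun t ht => ?_, fun t t' htt' ht' => ?_⟩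
    · simp only [ht, dif_pos]
      refine ⟨(mem_positions _ _).2 ?_, Nat.lt_succ_iff.2 (h1 _ (R.orderEmbOfFin_mem hR _)),
        Nat.lt_succ_iff.2 (h2 _ (S.orderEmbOfFin_mem hS _))⟩
      have h3 := hle (toLex (R.orderEmbOfFin hR ⟨t, ht⟩, S.orderEmbOfFin hS (Fin.rev ⟨t, ht⟩)))
      rw [permExponent_apply (R.orderEmbOfFin hR).injective, Fin.revPerm_apply, if_pos rfl] at h3
      omega
    · have ht : t < k := htt'.trans ht'
      simp only [ht, ht', dif_pos]
      exact ⟨(R.orderEmbOfFin hR).strictMono (Fin.mk_lt_mk.2 htt'),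
        (S.orderEmbOfFin hS).strictMono (Fin.rev_lt_rev.2 (Fin.mk_lt_mk.2 htt'))⟩
  · rintro ⟨i, j, hlt⟩
    rw [← nwRank_eq_matRank, ← Nat.succ_le_iff, le_chainRank_iff] at hlt
    rw [show (nwRank w i j).succ = 1 + nwRank w i j by omega] at hlt
    obtain ⟨r, c, h1, h2⟩ := hlt
    let ρ : Fin (1 + nwRank w i j) → Fin m := fun t => ⟨r t, by have := (h1 t t.2).2.1; omega⟩
    let κ : Fin (1 + nwRank w i j) → Fin n :=
      fun t => ⟨c t.rev, by have := (h1 t.rev t.rev.2).2.2; omega⟩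
    have hρ : StrictMono ρ := fun s t hst => (h2 s t hst t.2).1
    have hκ : StrictMono κ := fun s t hst => (h2 t.rev s.rev (Fin.rev_lt_rev.2 hst) s.rev.2).2
    have hR : (univ.image ρ).card = 1 + nwRank w i j := by
      rw [card_image_of_injective _ hρ.injective, card_univ, Fintype.card_fin]
    have hS : (univ.image κ).card = 1 + nwRank w i j := by
      rw [card_image_of_injective _ hκ.injective, card_univ, Fintype.card_fin]
    refine ⟨_, ⟨i, j, univ.image ρ, univ.image κ, hR, hS, ?_, ?_, rfl⟩, ?_⟩
    · intro x hx
      obtain ⟨t, -, rfl⟩ := mem_image.1 hx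
      exact Nat.lt_succ_iff.1 (h1 t t.2).2.1
    · intro x hx
      obtain ⟨t, -, rfl⟩ := mem_image.1 hx
      exact Nat.lt_succ_iff.1 (h1 t.rev t.rev.2).2.2
    · rw [← orderEmbOfFin_unique hR (fun t => mem_image_of_mem ρ (mem_univ t)) hρ,
        ← orderEmbOfFin_unique hS (fun t => mem_image_of_mem κ (mem_univ t)) hκ]
      intro s
      obtain ⟨⟨x, y⟩, rfl⟩ := toLex.surjective s
      by_cases hx : ∃ t, ρ t = x
      · obtain ⟨t, rfl⟩ := hx
        rw [permExponent_apply hρ.injective]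
        split_ifs with hy
        · rw [← hy, Fin.revPerm_apply, Nat.one_le_iff_ne_zero, ← mem_positions]
          simpa [ρ, κ] using (h1 t t.2).1
        · exact Nat.zero_le _
      · push Not at hx
        rw [permExponent_apply_of_notMem κ _ hx]
        exact Nat.zero_le _

theorem mem_antidiagIdeal_iff {w : Matrix (Fin m) (Fin n) K} {f : MvPolynomial (Pos m n) K} :
    f ∈ antidiagIdeal w ↔ ∀ e ∈ f.support, ∃ (i : Fin m) (j : Fin n),
      matRank w (i + 1) (j + 1) < chainRank (positions e) (i + 1) (j + 1) := by
  rw [antidiagIdeal_eq_span, mem_ideal_span_monomial_image]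
  exact forall₂_congr fun e _ => exists_antidiagExponent_le_iff

theorem antidiagIdeal_mono {v w : Matrix (Fin m) (Fin n) K}
    (h : ∀ i j, nwRank v i j ≤ nwRank w i j) : antidiagIdeal w ≤ antidiagIdeal v := by
  intro f hf
  rw [mem_antidiagIdeal_iff] at hf ⊢
  intro e he
  obtain ⟨i, j, hij⟩ := hf e he
  have := h i j
  rw [nwRank_eq_matRank, nwRank_eq_matRank] at this
  exact ⟨i, j, by omega⟩

/-- A variable at a position with northwest rank `0` is in the antidiagonal ideal. -/
theorem xVar_mem_antidiagIdeal {w : Matrix (Fin m) (Fin n) K} {i : Fin m} {j : Fin n}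
    (h : nwRank w i j = 0) :
    monomial (Finsupp.single (toLex (i, j)) 1) (1 : K) ∈ antidiagIdeal w := by
  classical
  rw [mem_antidiagIdeal_iff]
  intro e he
  rw [support_monomial, if_neg one_ne_zero, Finset.mem_singleton] at he
  refine ⟨i, j, ?_⟩
  rw [← nwRank_eq_matRank, h, Nat.lt_iff_add_one_le, le_chainRank_iff]
  refine ⟨fun _ => i, fun _ => j, fun t _ => ⟨(mem_positions i j).2 (by simp [he]), by simp,
    by simp⟩, fun t t' h1 h2 => by omega⟩

theorem initIdeal_matrixIdeal_zero :
    antidiagIdeal (0 : Matrix (Fin m) (Fin n) K) =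
      initIdeal (grevLex (Pos m n)) (matrixIdeal (MSV (0 : Matrix (Fin m) (Fin n) K))) := by
  refine le_antisymm (antidiagIdeal_le_initIdeal 0) ?_
  rw [initIdeal, Ideal.span_le]
  rintro _ ⟨f, hf, rfl⟩
  by_cases hf0 : f = 0
  · simp [initTerm, hf0]
  rw [initTerm, if_neg hf0]
  -- a polynomial without constant term has a nonconstant leading monomial
  have hdeg : (grevLex (Pos m n)).degree f ≠ 0 := by
    intro h
    have h1 := MonomialOrder.eq_C_of_degree_eq_zero h
    have h2 := mem_matrixIdeal.1 hf 0 (zero_mem_MSV 0)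
    rw [h1, evalAt, aeval_C] at h2
    simp only [Algebra.algebraMap_self, RingHom.id_apply] at h2
    rw [h2, C_0] at h1
    exact hf0 h1
  obtain ⟨s, hs⟩ := Finsupp.ne_iff.1 hdeg
  obtain ⟨⟨i, j⟩, rfl⟩ := toLex.surjective s
  have h0 : nwRank (0 : Matrix (Fin m) (Fin n) K) i j = 0 := by
    rw [nwRank_eq_matRank, matRank_zero]
  refine Ideal.mem_of_dvd _ ?_ (xVar_mem_antidiagIdeal h0)
  rw [monomial_dvd_monomial]
  refine ⟨Or.inr ?_, dvd_rfl⟩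
  intro s
  rw [Finsupp.single_apply]
  split_ifs with h
  · rw [← h]
    exact Nat.one_le_iff_ne_zero.2 hs
  · exact Nat.zero_le _

end Antidiagonal

end TransitionSystems

namespace TransitionSystems

open MvPolynomial

/-! ### Outer corners -/

section OuterCorner

variable {K : Type*} [Field K]

theorem permRank_eq_zero_iff {w : Equiv.Perm ℕ} {a b : ℕ} :
    permRank w a b = 0 ↔ ∀ k < a, b ≤ w k := by
  simp [permRank, Finset.filter_eq_empty_iff]

theorem mem_dom {w : Equiv.Perm ℕ} {x : ℕ × ℕ} : x ∈ dom K w ↔ ∀ k ≤ x.1, x.2 < w k := by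
  have h : (permMatrix K (x.1 + 1) (x.2 + 1) w).rank = permRank w (x.1 + 1) (x.2 + 1) := by
    rw [← matRank_permMatrix (K := K) w (le_refl (x.1 + 1)) (le_refl (x.2 + 1)), matRank]
    congr 1
    ext i j
    simp only [northwest, Matrix.of_apply]
    rw [if_pos ⟨i.2, j.2⟩]
  change (permMatrix K (x.1 + 1) (x.2 + 1) w).rank = 0 ↔ _
  rw [h, permRank_eq_zero_iff]
  simp only [Nat.lt_succ_iff, Nat.succ_le_iff]

theorem isOuterCorner_dom_iff {w : Equiv.Perm ℕ} {p q : ℕ} :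
    IsOuterCorner (dom K w) (p, q) ↔ w p = q ∧ ∀ k < p, q < w k := by
  constructor
  · rintro ⟨hnot, μ, hμ⟩
    have hmem : ∀ x : ℕ × ℕ, x ≤ (p, q) → x ≠ (p, q) → x ∈ dom K w := by
      intro x hx hne
      have h1 : (p, q) ∈ (μ : Set (ℕ × ℕ)) := hμ ▸ Set.mem_insert _ _
      have h2 : x ∈ (μ : Set (ℕ × ℕ)) := μ.isLowerSet hx h1
      rw [hμ] at h2
      exact h2.resolve_left hne
    have h1 : ∀ k < p, q < w k := by
      intro k hk
      exact mem_dom.1 (hmem (k, q) ⟨hk.le, le_rfl⟩ (fun h => hk.ne (Prod.mk.inj h).1)) k le_rfl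
    refine ⟨le_antisymm ?_ ?_, h1⟩
    · by_contra hlt
      refine hnot (mem_dom.2 fun k hk => ?_)
      rcases (show k ≤ p from hk).lt_or_eq with h | rfl
      · exact h1 k h
      · exact not_le.1 hlt
    · by_contra hlt
      have hlt := not_le.1 hlt
      have := mem_dom.1 (hmem (p, w p) ⟨le_rfl, hlt.le⟩ (fun h => hlt.ne (Prod.mk.inj h).2)) p le_rfl
      exact lt_irrefl _ this
  · rintro ⟨rfl, h1⟩
    have hfin : (dom K w).Finite := by
      refine ((Set.finite_lt_nat (w.symm 0)).prod (Set.finite_lt_nat (w 0))).subset ?_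
      intro x hx
      rw [mem_dom] at hx
      refine ⟨?_, hx 0 (Nat.zero_le _)⟩
      by_contra h
      have := hx (w.symm 0) (not_lt.1 h)
      simp at this
    refine ⟨fun h => lt_irrefl _ (mem_dom.1 h p le_rfl), ⟨(hfin.insert (p, w p)).toFinset, ?_⟩, ?_⟩
    · rw [Set.Finite.coe_toFinset]
      rintro x y hyx (rfl | hx)
      · by_cases hy : y = (p, w p)
        · exact Or.inl hy
        refine Or.inr (mem_dom.2 fun k hk => ?_)
        have h2 : y.1 ≤ p := hyx.1
        have h3 : y.2 ≤ w p := hyx.2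
        rcases (hk.trans h2).lt_or_eq with h | rfl
        · exact h3.trans_lt (h1 k h)
        · refine lt_of_le_of_ne h3 fun h4 => hy (Prod.ext (le_antisymm h2 hk) h4)
      · refine Or.inr (mem_dom.2 fun k hk => ?_)
        exact lt_of_le_of_lt hyx.2 (mem_dom.1 hx k (hk.trans hyx.1))
    · exact Set.Finite.coe_toFinset _

theorem exists_isOuterCorner {m n : ℕ} {w : Equiv.Perm ℕ} (h : permMatrix K m n w ≠ 0) :
    ∃ (p : Fin m) (q : Fin n), IsOuterCorner (dom K w) (p, q) := by
  classical
  have hex : ∃ p, p < m ∧ w p < n := by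
    by_contra! hno
    refine h (Matrix.ext fun i j => ?_)
    have := hno i i.2
    rw [permMatrix, Matrix.of_apply, if_neg (by omega)]
    rfl
  obtain ⟨h1, h2⟩ := Nat.find_spec hex
  refine ⟨⟨Nat.find hex, h1⟩, ⟨w (Nat.find hex), h2⟩, isOuterCorner_dom_iff.2 ⟨rfl, ?_⟩⟩
  intro k hk
  have := Nat.find_min hex hk
  simp only at *
  omega

end OuterCorner

/-! ### Transitions between matrix Schubert varieties -/

section Transition

variable {K : Type*} [Field K] {m n : ℕ}

theorem schubertPair_congr {v w : Matrix (Fin m) (Fin n) K}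
    (h : ∀ i j, nwRank v i j = nwRank w i j) : schubertPair v = schubertPair w := by
  have h1 : MSV v = MSV w := by
    ext M
    simp only [MSV, Set.mem_ofPred_eq, h]
  have h2 : antidiagIdeal v = antidiagIdeal w :=
    le_antisymm (antidiagIdeal_mono fun i j => (h i j).ge) (antidiagIdeal_mono fun i j => (h i j).le)
  rw [schubertPair, schubertPair, h1, h2]

theorem schubertSystem_finite (K : Type*) [Field K] (m n : ℕ) : (schubertSystem K m n).Finite := by
  have hlt : ∀ (w : Matrix (Fin m) (Fin n) K) i j, nwRank w i j < m + 1 := by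
    intro w i j
    rw [nwRank_eq_matRank]
    exact Nat.lt_succ_iff.2 (Matrix.rank_le_height _)
  let table : Matrix (Fin m) (Fin n) K → Fin m → Fin n → Fin (m + 1) :=
    fun w i j => ⟨nwRank w i j, hlt w i j⟩
  have hf : Function.FactorsThrough (fun w : Matrix (Fin m) (Fin n) K => schubertPair w) table := by
    intro v w h
    exact schubertPair_congr fun i j => congrArg Fin.val (congrFun (congrFun h i) j)
  obtain ⟨e, he⟩ := (Function.factorsThrough_iff _).1 hf
  refine (Set.finite_range e).subset ?_
  rintro _ ⟨w, rfl⟩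
  exact ⟨table w, (congrFun he w).symm⟩

theorem nwRank_permMatrix (w : Equiv.Perm ℕ) (i : Fin m) (j : Fin n) :
    nwRank (permMatrix K m n w) i j = permRank w (i + 1) (j + 1) := by
  rw [nwRank_eq_matRank, matRank_permMatrix w i.2 j.2]

theorem exists_mem_SInf_schubertPair (M : Matrix (Fin m) (Fin n) K) :
    ∃ w ∈ SInf m n, schubertPair (permMatrix K m n w) = schubertPair M := by
  obtain ⟨w, hw, h⟩ := exists_mem_SInf_of_isRankFn (matRank_isRankFn M) m n
  refine ⟨w, hw, schubertPair_congr fun i j => ?_⟩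
  rw [nwRank_permMatrix, nwRank_eq_matRank, h _ _ i.2 j.2]

theorem schubertSystem_eq_image (K : Type*) [Field K] (m n : ℕ) :
    schubertSystem K m n = (fun w => schubertPair (permMatrix K m n w)) '' SInf m n := by
  apply Set.Subset.antisymm
  · rintro _ ⟨M, rfl⟩
    obtain ⟨w, hw, h⟩ := exists_mem_SInf_schubertPair M
    exact ⟨w, hw, h⟩
  · rintro _ ⟨w, -, rfl⟩
    exact ⟨permMatrix K m n w, rfl⟩

/-- A rank function that does not exceed the one of `w` on the window, and is strictly below it at a
one of `w` in row `p`, does not exceed the one of some `w t_pr` covering `w`. -/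
theorem exists_mem_transitionCovers {ρ : ℕ → ℕ → ℕ} (hρ : IsRankFn ρ) {w : Equiv.Perm ℕ}
    (hw : {i | w i ≠ i}.Finite)
    (hle : ∀ (i : Fin m) (j : Fin n), ρ (i + 1) (j + 1) ≤ permRank w (i + 1) (j + 1))
    {p : ℕ} (hp : p < m) (hq : w p < n)
    (hlt : ρ (p + 1) (w p + 1) < permRank w (p + 1) (w p + 1)) :
    ∃ v ∈ transitionCovers w p,
      ∀ (i : Fin m) (j : Fin n), ρ (i + 1) (j + 1) ≤ permRank v (i + 1) (j + 1) := by
  obtain ⟨r, hr, h⟩ := exists_coverPair_le (hρ.window m n) hw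
    (fun a b => (hρ.le_of_window hle (min_le_right a m) (min_le_right b n)).trans
      (((permRank_isRankFn w).le_left (min_le_left a m) _).trans
        ((permRank_isRankFn w).le_right a (min_le_left b n))))
    (p := p)
    (by simpa only [min_eq_left (Nat.succ_le_of_lt hp), min_eq_left (Nat.succ_le_of_lt hq)] using hlt)
  refine ⟨_, mem_transitionCovers.2 ⟨r, hr, rfl⟩, fun i j => ?_⟩
  simpa only [min_eq_left (Nat.succ_le_of_lt i.2), min_eq_left (Nat.succ_le_of_lt j.2)]
    using h (i + 1) (j + 1)

theorem permRank_le_of_mem_transitionCovers {w v : Equiv.Perm ℕ} {p : ℕ}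
    (hv : v ∈ transitionCovers w p) (a b : ℕ) : permRank v a b ≤ permRank w a b := by
  obtain ⟨r, hr, rfl⟩ := mem_transitionCovers.1 hv
  have := permRank_mul_swap hr.1 hr.2.1 a b
  omega

theorem permRank_corner {w : Equiv.Perm ℕ} {p : ℕ} (hcorner : ∀ k < p, w p < w k) :
    permRank w p (w p + 1) = 0 ∧ permRank w (p + 1) (w p + 1) = 1 := by
  have h1 : permRank w p (w p + 1) = 0 := permRank_eq_zero_iff.2 hcorner
  refine ⟨h1, ?_⟩
  rw [permRank_succ_left, h1, if_pos (Nat.lt_succ_self _)]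

theorem permRank_eq_zero_of_mem_transitionCovers {w v : Equiv.Perm ℕ} {p : ℕ}
    (hcorner : ∀ k < p, w p < w k) (hv : v ∈ transitionCovers w p) :
    permRank v (p + 1) (w p + 1) = 0 := by
  obtain ⟨r, ⟨hpr, hlt, -⟩, rfl⟩ := mem_transitionCovers.1 hv
  have := permRank_mul_swap hpr hlt (p + 1) (w p + 1)
  rw [if_pos (by omega), (permRank_corner hcorner).2] at this
  omega

theorem matrixIdeal_sup_le {w v : Equiv.Perm ℕ} {p : Fin m} {q : Fin n} (hq : w p = q)
    (hcorner : ∀ k < p.1, w p < w k) (hv : v ∈ transitionCovers w p) :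
    matrixIdeal (MSV (permMatrix K m n w)) ⊔ Ideal.span {xVar K p q} ≤
      matrixIdeal (MSV (permMatrix K m n v)) := by
  apply sup_le
  · intro g hg
    rw [mem_matrixIdeal] at hg ⊢
    intro M hM
    rw [mem_MSV_permMatrix] at hM
    exact hg M (mem_MSV_permMatrix.2 fun a b ha hb =>
      (hM a b ha hb).trans (permRank_le_of_mem_transitionCovers hv a b))
  · rw [Ideal.span_le, Set.singleton_subset_iff, SetLike.mem_coe, mem_matrixIdeal]
    intro M hM
    rw [mem_MSV_permMatrix] at hM
    rw [evalAt_xVar]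
    apply apply_eq_zero_of_matRank_eq_zero
    have h := hM (p + 1) (q + 1) p.2 q.2
    rw [← hq, permRank_eq_zero_of_mem_transitionCovers hcorner hv] at h
    rw [← hq]
    omega

/-- The combinatorial heart: a set of positions that avoids an outer corner of `dom w`, and whose
antidiagonals are as short as `w` permits, has antidiagonals as short as some cover of `w`
permits. -/
theorem antidiagIdeal_sup_eq {w : Equiv.Perm ℕ} (hw : {i | w i ≠ i}.Finite) {p : Fin m} {q : Fin n}
    (hq : w p = q) (hcorner : ∀ k < p.1, w p < w k) :
    antidiagIdeal (permMatrix K m n w) ⊔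
        Ideal.span {initTerm (grevLex (Pos m n)) (xVar K p q)} =
      ⨅ v ∈ transitionCovers w p, antidiagIdeal (permMatrix K m n v) := by
  apply le_antisymm
  · refine le_iInf₂ fun v hv => sup_le (antidiagIdeal_mono fun i j => ?_) ?_
    · rw [nwRank_permMatrix, nwRank_permMatrix]
      exact permRank_le_of_mem_transitionCovers hv _ _
    · rw [Ideal.span_le, Set.singleton_subset_iff, initTerm_xVar]
      apply xVar_mem_antidiagIdeal
      rw [nwRank_permMatrix, ← hq, permRank_eq_zero_of_mem_transitionCovers hcorner hv]
  · intro f hf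
    rw [initTerm_xVar, antidiagIdeal_eq_span, ← Ideal.span_union,
      ← Set.image_singleton (f := fun e => monomial e (1 : K)),
      ← Set.image_union, mem_ideal_span_monomial_image]
    intro e he
    by_cases hpq : (p.1, q.1) ∈ positions e
    · refine ⟨_, Or.inr rfl, fun s => ?_⟩
      rw [Finsupp.single_apply]
      split_ifs with hs
      · rw [← hs, Nat.one_le_iff_ne_zero, ← mem_positions]
        exact hpq
      · exact Nat.zero_le _
    · suffices h : ∃ e' ∈ antidiagExponents (permMatrix K m n w), e' ≤ e by
        obtain ⟨e', h1, h2⟩ := h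
        exact ⟨e', Or.inl h1, h2⟩
      rw [exists_antidiagExponent_le_iff]
      by_contra! hle
      simp only [← nwRank_eq_matRank, nwRank_permMatrix] at hle
      have hlt : chainRank (positions e) (p + 1) (w p + 1) < permRank w (p + 1) (w p + 1) := by
        have h1 := hle p q
        rw [← hq] at h1
        refine lt_of_le_of_ne h1 fun h2 => hpq ?_
        rw [(permRank_corner hcorner).2] at h2
        obtain ⟨r, c, h3, -⟩ := le_chainRank_iff.1 h2.ge
        obtain ⟨⟨hr, hc, hne⟩, hrp, hcq⟩ := h3 0 Nat.one_pos
        -- the only candidate position is `(p, q)`, as `e` avoids the diagram `dom w`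
        have hzero : ∀ (i : Fin m) (j : Fin n), permRank w (i + 1) (j + 1) = 0 →
            (i.1, j.1) ∉ positions e := by
          intro i j h4 h5
          have h6 := hle i j
          rw [h4, Nat.le_zero] at h6
          have h7 : 1 ≤ chainRank (positions e) (i + 1) (j + 1) :=
            le_chainRank_iff.2 ⟨fun _ => i, fun _ => j, fun t _ => ⟨h5, by simp, by simp⟩,
              fun t t' h1 h2 => by omega⟩
          omega
        have h8 := mt (hzero ⟨r 0, hr⟩ ⟨c 0, hc⟩) (not_not.2 ⟨hr, hc, hne⟩)
        rw [permRank_eq_zero_iff] at h8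
        push Not at h8
        obtain ⟨k, hk1, hk2⟩ := h8
        simp only at hk1 hk2
        have hkp : ¬ k < p.1 := fun h => by have := hcorner k h; omega
        have hk : k = p := by omega
        rw [hk] at hk2
        have e1 : r 0 = p := by omega
        have e2 : c 0 = q := by omega
        rw [← e1, ← e2]
        exact ⟨hr, hc, hne⟩
      obtain ⟨v, hv, h⟩ := exists_mem_transitionCovers (chainRank_isRankFn (positions e)) hw hle
        p.2 (hq ▸ q.2) hlt
      have hfv : f ∈ antidiagIdeal (permMatrix K m n v) := by
        rw [Submodule.mem_iInf] at hf
        exact (Submodule.mem_iInf _).1 (hf v) hv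
      obtain ⟨i, j, hij⟩ := mem_antidiagIdeal_iff.1 hfv e he
      rw [← nwRank_eq_matRank, nwRank_permMatrix] at hij
      exact absurd (h i j) (not_le.2 hij)

theorem apply_corner_ne_zero {w : Equiv.Perm ℕ} {p : Fin m} {q : Fin n} (hq : w p = q)
    (hcorner : ∀ k < p.1, w p < w k) {N : Matrix (Fin m) (Fin n) K}
    (hN : ∀ a b, a ≤ m → b ≤ n → matRank N a b = permRank w a b) : N p q ≠ 0 := by
  classical
  intro h0
  have hz : truncRow N (q + 1) p = 0 := by
    ext j
    simp only [truncRow, Pi.zero_apply]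
    split_ifs with hj
    · rcases (Nat.lt_succ_iff.1 hj).lt_or_eq with h | h
      · apply apply_eq_zero_of_matRank_eq_zero
        rw [hN _ _ p.2 j.2, permRank_eq_zero_iff]
        intro k hk
        rcases (Nat.lt_succ_iff.1 hk).lt_or_eq with h' | h'
        · have := hcorner k h'; omega
        · rw [h']; omega
      · rw [Fin.ext h, h0]
    · rfl
  have h1 := matRank_succ N p (q + 1)
  rw [hz, if_pos (Submodule.zero_mem _), hN _ _ p.2 q.2, hN _ _ p.2.le q.2, ← hq,
    (permRank_corner hcorner).1, (permRank_corner hcorner).2] at h1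
  omega

theorem transitionCovers_subset {w : Equiv.Perm ℕ} (hw : w ∈ SInf m n) {p : Fin m} {q : Fin n}
    (hq : w p = q) : transitionCovers w p ⊆ SInf m n := by
  intro v hv
  obtain ⟨r, hr, rfl⟩ := mem_transitionCovers.1 hv
  exact mul_swap_mem_SInf hw p.2 (hq ▸ q.2) hr

theorem isTransition_corner [Infinite K] {w : Equiv.Perm ℕ} (hw : w ∈ SInf m n) {p : Fin m}
    {q : Fin n} (hpq : IsOuterCorner (dom K w) (p, q)) :
    IsTransition (grevLex (Pos m n)) (schubertSystem K m n)
      (matrixIdeal (MSV (permMatrix K m n w))) (antidiagIdeal (permMatrix K m n w)) (xVar K p q)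
      ((fun v => schubertPair (permMatrix K m n v)) '' transitionCovers w p) := by
  obtain ⟨hq, hcorner⟩ := isOuterCorner_dom_iff.1 hpq
  rw [← hq] at hcorner
  have hsub : (fun v => schubertPair (permMatrix K m n v)) '' transitionCovers w p ⊆
      schubertSystem K m n := by
    rintro _ ⟨v, -, rfl⟩
    exact ⟨permMatrix K m n v, rfl⟩
  refine ⟨fun c hc => ?_, fun h => ?_, ?_, (schubertSystem_finite K m n).subset hsub, hsub, ?_, ?_,
    fun h => absurd (colon_xVar_eq hw.1 fun N hN => apply_corner_ne_zero hq hcorner hN) h⟩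
  · have h0 := congrArg (evalAt (0 : Matrix (Fin m) (Fin n) K)) hc
    have h1 := congrArg (evalAt (Matrix.of fun _ _ => 1 : Matrix (Fin m) (Fin n) K)) hc
    rw [evalAt_xVar, evalAt, aeval_C] at h0 h1
    rw [← h0] at h1
    simp at h1
  · have := mem_matrixIdeal.1 h _ (self_mem_MSV _)
    rw [evalAt_xVar, permMatrix, Matrix.of_apply, if_pos hq] at this
    exact one_ne_zero this
  · have hzero : IsRankFn fun _ _ => 0 := by constructor <;> simp
    obtain ⟨v, hv, -⟩ := exists_mem_transitionCovers (m := m) (n := n) hzero hw.1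
      (fun _ _ => Nat.zero_le _) p.2 (hq ▸ q.2) (by rw [(permRank_corner hcorner).2]; exact one_pos)
    exact ⟨_, v, hv, rfl⟩
  · rw [iInf_image]
    exact le_iInf₂ fun v hv => matrixIdeal_sup_le hq hcorner hv
  · rw [iInf_image]
    exact antidiagIdeal_sup_eq hw.1 hq hcorner

theorem isTransitionSystem_schubertSystem (K : Type*) [Field K] [Infinite K] (m n : ℕ) :
    IsTransitionSystem (grevLex (Pos m n)) (schubertSystem K m n) where
  proper := by
    rintro _ ⟨w, rfl⟩
    exact ⟨matrixIdeal_ne_top w, antidiagIdeal_ne_top w⟩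
  monomial := by
    rintro _ ⟨w, rfl⟩
    exact ⟨_, antidiagIdeal_eq_span w⟩
  le_init := by
    rintro _ ⟨w, rfl⟩
    exact antidiagIdeal_le_initIdeal w
  eq_init := by
    rintro _ ⟨w, rfl⟩ h
    obtain rfl := eq_zero_of_isMaximal h
    exact initIdeal_matrixIdeal_zero
  unique := by
    rintro _ ⟨v, rfl⟩ _ ⟨w, rfl⟩ h
    exact congrArg Prod.snd (schubertPair_congr (nwRank_eq_of_matrixIdeal_eq h))
  transition := by
    intro P hP hmax _
    rw [schubertSystem_eq_image] at hP
    obtain ⟨w, hw, rfl⟩ := hP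
    have h0 : permMatrix K m n w ≠ 0 := by
      intro h
      apply hmax
      simp only [schubertPair, h]
      exact isMaximal_zero
    obtain ⟨p, q, hpq⟩ := exists_isOuterCorner h0
    exact ⟨_, _, isTransition_corner hw hpq⟩

end Transition

end TransitionSystems

open TransitionSystems
theorem theorem4p2 {K : Type*} [Field K] [IsAlgClosed K] (m n : ℕ) (hm : 0 < m) (hn : 0 < n) :
    (schubertSystem K m n).Finite ∧
    IsTransitionSystem
      (grevLex (Pos m n))
      (schubertSystem K m n) ∧
    -- the system is indexed by a finite set of permutations
    schubertSystem K m n =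
      (fun w => schubertPair (permMatrix K m n w)) ''
        SInf m n ∧
    -- the explicit choice of `f` and `Φ`
    ∀ w ∈ SInf m n,
      ¬ (matrixIdeal
          (MSV (permMatrix K m n w))).IsMaximal →
      (∃ (p : Fin m) (q : Fin n),
        IsOuterCorner (dom K w) (p, q)) ∧
      ∀ (p : Fin m) (q : Fin n),
        IsOuterCorner (dom K w) (p, q) →
        transitionCovers w p ⊆ SInf m n ∧
        IsTransition
          (grevLex (Pos m n))
          (schubertSystem K m n)
          (matrixIdeal
            (MSV (permMatrix K m n w)))
          (antidiagIdeal (permMatrix K m n w))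
          (xVar K p q)
          ((fun v => schubertPair (permMatrix K m n v)) ''
            transitionCovers w p) := by
  refine ⟨schubertSystem_finite K m n, isTransitionSystem_schubertSystem K m n,
    schubertSystem_eq_image K m n, fun w hw hmax => ⟨exists_isOuterCorner fun h => ?_,
      fun p q hpq => ⟨?_, isTransition_corner hw hpq⟩⟩⟩
  · rw [h] at hmax
    exact hmax isMaximal_zero
  · exact transitionCovers_subset hw (isOuterCorner_dom_iff.1 hpq).1
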